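/- There are universal constants $C_1,C_2>0$ such that the following holds. Let $\xi$ have law $\mathbb P_\xi$, and for every value of $\xi$ let $\mathbf H(\xi)\in\mathbb R^{d\times d}$ be symmetric positive semidefinite and $\mathbf b(\xi)\in\mathbb R^d$ ($d\ge 1$), both measurable and integrable in $\xi$. Put $$f(\mathbf w)=\mathbb E_\xi[F(\mathbf w,\xi)],\qquad F(\mathbf w,\xi)=\tfrac12\mathbf w^\top\mathbf H(\xi)\mathbf w-\mathbf b(\xi)^\top\mathbf w,\qquad \mathbf H=\mathbb E[\mathbf H(\xi)]=\nabla^2 f .$$ Assume that $f$ has a minimizer, and let $\mathbf w_*$ be one. Let $\lambda_1\ge\dots\ge\lambda_d$ be the eigenvalues of $\mathbf H$, with orthonormal eigenvectors $\mathbf v_1,\dots,\mathbf v_d$, and write $\mathbf w^{(j)}=\mathbf v_j^\top\mathbf w$. Let $\xi_0,\xi_1,\dots$ be independent with law $\mathbb P_\xi$. Let $T\ge 16$ be an integer, $A=256\,\log_2T\cdot\ln T$, and assume $A\le T$. Let $\eta_0>0$ with $\lambda_1\eta_0\le 1$, and let $\beta\in[0,(1-A/T)^2]$. The stochastic heavy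 ball method starts from $\mathbf w_0=\mathbf u_0=\mathbf 0$ and iterates, for $0\le t<T$, $$\mathbf u_{t+1}=\beta\mathbf u_t+\eta_t\bigl(\mathbf H(\xi_t)\mathbf w_t-\mathbf b(\xi_t)\bigr),\qquad \mathbf w_{t+1}=\mathbf w_t-\mathbf u_{t+1},$$ with the exponentially decaying step size $\eta_t=\eta_0/4^{\ell-1}$ for $K(\ell-1)\le t<K\ell$, $\ell=1,2,\dots$, where $K=T/\log_2T$; that is, $\eta_t=\eta_0\,4^{-\lfloor t/K\rfloor}$. Let $\boldsymbol\zeta_t=\mathbf H(\xi_t)\mathbf w_t-\mathbf b(\xi_t)-\nabla f(\mathbf w_t)$ be the gradient noise. Assume that, for some real $\sigma$ and all $0\le t<T$, $\boldsymbol\zeta_t$ is square integrable and almost surely $$\mathbb E[\boldsymbol\zeta_t\mid\mathbf w_t]=\mathbf 0,\qquad \mathbb E[\boldsymbol\zeta_t\boldsymbol\zeta_t^\top\mid\mathbf w_t]\preceq\sigma^2\mathbf H .$$ Then $f(\mathbf w_T)$ is integrable and $$\begin{aligned}\mathbb E[f(\mathbf w_T)]-f(\mathbf w_*)\le{}& C_1\Bigl(\sum_{j=1}^{k^*}\frac{(\log_2T)^2A(1-\sqrt\beta)}{\eta_0T}\bigl(\mathbf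 w_*^{(j)}\bigr)^2+\sum_{j=k^*+1}^{d}\lambda_j(\log_2T)^2\bigl(\mathbf w_*^{(j)}\bigr)^2\Bigr)\\&+C_2\sigma^2\Bigl(\frac{(\lambda_1^2\eta_0^2+A^2)k^*}{T}+\eta_0^2\sum_{j=k^*+1}^{d}\lambda_j^2\,T\,\frac1{(1-\sqrt\beta)^2}\Bigr),\end{aligned}$$ where $k^*=\max\{k:\lambda_k\eta_0\ge(1-\sqrt\beta)/T\}$, and $k^*=0$ if there is no such $k$. -/

import Mathlib

open MeasureTheory ProbabilityTheory

noncomputable section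

/-- A stochastic quadratic objective `f w = 𝔼[F w ξ]` with
`F w ξ = (1/2) wᵀ H(ξ) w - b(ξ)ᵀ w`, where `ξ` has the law `law`. -/
structure StochasticQuadratic (Ξ : Type*) [MeasurableSpace Ξ] (d : ℕ) where
  law : Measure Ξ
  isProb : IsProbabilityMeasure law
  H : Ξ → Matrix (Fin d) (Fin d) ℝ
  b : Ξ → EuclideanSpace ℝ (Fin d)
  measurable_H : ∀ i j, Measurable fun s => H s i j
  measurable_b : Measurable b
  posSemidef_H : ∀ s, (H s).PosSemidef
  integrable_H : ∀ i j, Integrable (fun s => H s i j) law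
  integrable_b : Integrable b law

namespace StochasticQuadratic

variable {Ξ : Type*} [MeasurableSpace Ξ] {d : ℕ}

/-- The individual function `F w ξ`. -/
def F (Q : StochasticQuadratic Ξ d) (w : EuclideanSpace ℝ (Fin d)) (s : Ξ) : ℝ :=
  1 / 2 * inner ℝ w (Matrix.toEuclideanLin (Q.H s) w) - inner ℝ (Q.b s) w

/-- The objective `f w = 𝔼[F w ξ]`. -/
def f (Q : StochasticQuadratic Ξ d) (w : EuclideanSpace ℝ (Fin d)) : ℝ :=
  ∫ s, Q.F w s ∂Q.law

/-- The population Hessian `𝔼[H(ξ)]`. -/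
def meanH (Q : StochasticQuadratic Ξ d) : Matrix (Fin d) (Fin d) ℝ :=
  Matrix.of fun i j => ∫ s, Q.H s i j ∂Q.law

/-- The population vector `𝔼[b(ξ)]`. -/
def meanB (Q : StochasticQuadratic Ξ d) : EuclideanSpace ℝ (Fin d) :=
  ∫ s, Q.b s ∂Q.law

/-- The full gradient `∇f(w) = 𝔼[H(ξ)] w - 𝔼[b(ξ)]`. -/
def grad (Q : StochasticQuadratic Ξ d) (w : EuclideanSpace ℝ (Fin d)) :
    EuclideanSpace ℝ (Fin d) :=
  Matrix.toEuclideanLin Q.meanH w - Q.meanB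

/-- The stochastic gradient `∇F(w, ξ) = H(ξ) w - b(ξ)`. -/
def stochGrad (Q : StochasticQuadratic Ξ d) (w : EuclideanSpace ℝ (Fin d)) (s : Ξ) :
    EuclideanSpace ℝ (Fin d) :=
  Matrix.toEuclideanLin (Q.H s) w - Q.b s

/-- The pairs `(w_t, u_t)` of the heavy ball method with step sizes `η t`, momentum `β`, initial
point `w₀` and `u_0 = 0`, run on the samples `s 0, s 1, …`:
`u_{t+1} = β u_t + η_t ∇F(w_t, s_t)` and `w_{t+1} = w_t - u_{t+1}`. -/
def heavyBall (Q : StochasticQuadratic Ξ d) (η : ℕ → ℝ) (β : ℝ)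
    (w₀ : EuclideanSpace ℝ (Fin d)) (s : ℕ → Ξ) :
    ℕ → EuclideanSpace ℝ (Fin d) × EuclideanSpace ℝ (Fin d)
  | 0 => (w₀, 0)
  | t + 1 =>
    let w := (heavyBall Q η β w₀ s t).1
    let u := (heavyBall Q η β w₀ s t).2
    let u' := β • u + η t • Q.stochGrad w (s t)
    (w - u', u')

/-- The gradient noise `ζ_t = ∇F(w_t, ξ_t) - ∇f(w_t)` along the random iterates `w`. -/
def gradNoise (Q : StochasticQuadratic Ξ d) {Ω : Type*} (ξ : ℕ → Ω → Ξ)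
    (w : ℕ → Ω → EuclideanSpace ℝ (Fin d)) (t : ℕ) (ω : Ω) : EuclideanSpace ℝ (Fin d) :=
  Q.stochGrad (w t ω) (ξ t ω) - Q.grad (w t ω)

/-- The anisotropic gradient noise assumption for the steps `t < T`: almost surely
`𝔼[ζ_t | w_t] = 0` and `𝔼[ζ_t ζ_tᵀ | w_t] ⪯ σ² H`. Square integrability of `ζ_t` is listed because
`condExp` is `0` on functions that are not integrable. -/
structure AnisotropicNoise (Q : StochasticQuadratic Ξ d) {Ω : Type*} [MeasurableSpace Ω]
    (μ : Measure Ω) (ξ : ℕ → Ω → Ξ) (w : ℕ → Ω → EuclideanSpace ℝ (Fin d))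
    (T : ℕ) (σ : ℝ) : Prop where
  memLp : ∀ t < T, MemLp (Q.gradNoise ξ w t) 2 μ
  mean_zero : ∀ t < T,
    condExp (MeasurableSpace.comap (w t) inferInstance) μ (Q.gradNoise ξ w t) =ᵐ[μ] 0
  second_moment_le : ∀ t < T, ∀ᵐ ω ∂μ,
    (σ ^ 2 • Q.meanH - Matrix.of fun i j =>
      condExp (MeasurableSpace.comap (w t) inferInstance) μ
        (fun ω' => Q.gradNoise ξ w t ω' i * Q.gradNoise ξ w t ω' j) ω).PosSemidef

end StochasticQuadratic

/-- The exponentially decaying schedule: with stages of length `K = T / log₂ T`, the step size is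
`η₀ / 4 ^ (ℓ - 1)` in the `ℓ`-th stage `K (ℓ - 1) ≤ t < K ℓ`, that is, `ℓ - 1 = ⌊t / K⌋`. -/
def stepSize (η₀ : ℝ) (T t : ℕ) : ℝ :=
  η₀ / 4 ^ ⌊(t : ℝ) / ((T : ℝ) / Real.logb 2 T)⌋₊

/-- `A = 256 log₂ T · ln T`. -/
def momentumA (T : ℕ) : ℝ :=
  256 * Real.logb 2 T * Real.log T

/-- `k* = max {k : λ_k η₀ ≥ (1 - √β) / T}`, and `0` if there is no such `k`. The eigenvalue `λ_k` of
one-based index `k` is `lam j` with `k = j + 1`. -/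
def kStar {d : ℕ} (lam : Fin d → ℝ) (η₀ β : ℝ) (T : ℕ) : ℕ :=
  (Finset.univ.filter fun j : Fin d => lam j * η₀ ≥ (1 - √β) / T).sup fun j => (j : ℕ) + 1

end

/-! Since `f` is quadratic, the error projected on an eigenvector with eigenvalue λ obeys a scalar
second-order recurrence with coefficients λη_t, driven by the projected noise. By variation of
constants (`heavyBall_eq_sol_sub_sum`) the last error is a deterministic bias minus a linear
combination of the noises. The sample at step t is independent of the past, so the noises are
orthogonal, and their second moments are at most σ²λ. Hence the risk along each eigenvector is at
most λ/2 times the squared bias plus σ²λ times the sum of squared noise responses, and only scalar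
estimates remain.

Put r = √β and q = λη₀, and let K be the stage length. The recurrence with constant coefficient p
changes character at p = (1 - r)². Above it the characteristic roots are conjugate of modulus r, and
a state decays like n rⁿ. Below it a cone of states is invariant, and a slow variable decays like
exp(-∑p / (2(1 - r))), even for varying p. The choice of A gives (1 - r)K ≥ 256 ln T. So a full
underdamped stage does not expand the state, and the first overdamped stage after it, where p still
exceeds (1 - r)²/4, contracts by a large power of T (`abs_sol_stageStart_le`). Handling one stage at
a time avoids products of non-commuting transition matrices.

If the relevant coefficient starts overdamped, one full stage and the inequality x e⁻ˣ ≤ 1 suffice.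
This yields `mul_sq_bias_le` and `mul_abs_response_le`, the latter with a bound of order log₂T / T
for every t. For q ≤ (1 - r)/T everything is overdamped and the crude bounds without decay are used.
The two kinds of estimate are summed below and above k*. -/

/-! ### The scalar heavy ball recurrence. -/

/-- The solution of the heavy ball recurrence
`y (n + 2) = (1 + β - p n) y (n + 1) - β y n` with `y 0 = a` and `y 1 = b`. -/
def heavyBallSol (β : ℝ) (p : ℕ → ℝ) (a b : ℝ) : ℕ → ℝ
  | 0 => a
  | 1 => b
  | n + 2 => (1 + β - p n) * heavyBallSol β p a b (n + 1) - β * heavyBallSol β p a b n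

theorem heavyBallSol_add (β : ℝ) (p : ℕ → ℝ) (a b : ℝ) (m : ℕ) (n : ℕ) :
    heavyBallSol β p a b (m + n) =
      heavyBallSol β (fun i => p (m + i)) (heavyBallSol β p a b m)
        (heavyBallSol β p a b (m + 1)) n := by
  induction n using Nat.twoStepInduction with
  | zero => rfl
  | one => rfl
  | more n ih₀ ih₁ =>
    have h : m + (n + 2) = (m + n) + 2 := rfl
    rw [h, heavyBallSol, heavyBallSol, ih₀, ← ih₁, add_assoc]

theorem heavyBallSol_linear (β : ℝ) (p : ℕ → ℝ) (x y a b a' b' : ℝ) (n : ℕ) :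
    heavyBallSol β p (x * a + y * a') (x * b + y * b') n =
      x * heavyBallSol β p a b n + y * heavyBallSol β p a' b' n := by
  induction n using Nat.twoStepInduction with
  | zero => rfl
  | one => rfl
  | more n ih₀ ih₁ =>
    simp only [heavyBallSol, ih₀, ih₁]
    ring

theorem heavyBallSol_congr {β : ℝ} {p p' : ℕ → ℝ} (a b : ℝ) {N : ℕ} (h : ∀ i < N, p i = p' i) :
    ∀ n ≤ N + 1, heavyBallSol β p a b n = heavyBallSol β p' a b n := by
  intro n
  induction n using Nat.twoStepInduction with
  | zero => intro _; rfl
  | one => intro _; rfl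
  | more n ih₀ ih₁ =>
    intro hn
    simp only [heavyBallSol, ih₀ (by omega), ih₁ (by omega), h n (by omega)]

/-! ### Overdamped regime: coefficients at most (1 - r)². -/

section Overdamped

variable {r : ℝ} {p : ℕ → ℝ}

/-- At the critical coefficient (1 - r)² the characteristic polynomial has the double root r;
smaller coefficients only increase the next value, so the ratio of consecutive values cannot drop
below r. Monotonicity persists because the new increment is r² times the old one minus a nonnegative
term. -/
theorem heavyBallSol_mem_cone (hr : 0 ≤ r) (hp : ∀ n, 0 ≤ p n)
    (hp' : ∀ n, p n ≤ (1 - r) ^ 2) {a b : ℝ} (ha : 0 ≤ a) (hab : r * a ≤ b) (hba : b ≤ a) (n : ℕ) :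
    0 ≤ heavyBallSol (r ^ 2) p a b n ∧
      r * heavyBallSol (r ^ 2) p a b n ≤ heavyBallSol (r ^ 2) p a b (n + 1) ∧
      heavyBallSol (r ^ 2) p a b (n + 1) ≤ heavyBallSol (r ^ 2) p a b n := by
  induction n with
  | zero => exact ⟨ha, hab, hba⟩
  | succ n ih =>
    obtain ⟨h0, h1, h2⟩ := ih
    have h3 : 0 ≤ heavyBallSol (r ^ 2) p a b (n + 1) := (mul_nonneg hr h0).trans h1
    refine ⟨h3, ?_, ?_⟩
    · have h4 := mul_le_mul_of_nonneg_right (hp' n) h3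
      have h5 := mul_le_mul_of_nonneg_left h1 hr
      rw [heavyBallSol]
      nlinarith
    · have h4 := mul_nonneg (hp n) h3
      have h5 := mul_le_mul_of_nonneg_left h2 (sq_nonneg r)
      rw [heavyBallSol]
      nlinarith

/-- In the overdamped regime the slow variable `y - β / (1 - β) u` contracts. -/
theorem heavyBallSol_slow_le (hr : 0 ≤ r) (hr1 : r < 1) (hp : ∀ n, 0 ≤ p n)
    (hp' : ∀ n, p n ≤ (1 - r) ^ 2) {a b : ℝ} (ha : 0 ≤ a) (hab : r * a ≤ b) (hba : b ≤ a) (n : ℕ) :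
    (1 - r ^ 2) * heavyBallSol (r ^ 2) p a b (n + 1)
        - r ^ 2 * (heavyBallSol (r ^ 2) p a b n - heavyBallSol (r ^ 2) p a b (n + 1)) ≤
      (1 - r ^ 2) * b * Real.exp (-(∑ i ∈ Finset.range n, p i) / (2 * (1 - r))) := by
  induction n with
  | zero =>
    have := mul_nonneg (sq_nonneg r) (sub_nonneg.2 hba)
    simp only [heavyBallSol, Finset.range_zero, Finset.sum_empty, neg_zero, zero_div,
      Real.exp_zero]
    linarith
  | succ n ih =>
    obtain ⟨h0, h1, h2⟩ := heavyBallSol_mem_cone hr hp hp' ha hab hba n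
    have hδ : 0 < 1 - r := sub_pos.2 hr1
    have h3 : 0 ≤ heavyBallSol (r ^ 2) p a b (n + 1) := (mul_nonneg hr h0).trans h1
    set y := heavyBallSol (r ^ 2) p a b (n + 1) with hy
    set x := heavyBallSol (r ^ 2) p a b n with hx
    have hβ : 0 < 1 - r ^ 2 := by nlinarith
    have hm : 0 ≤ (1 - r ^ 2) * y - r ^ 2 * (x - y) := by
      have := mul_le_mul_of_nonneg_left h1 hr
      nlinarith
    have hm' : (1 - r ^ 2) * y - r ^ 2 * (x - y) ≤ (1 - r ^ 2) * y := by
      nlinarith [mul_nonneg (sq_nonneg r) (sub_nonneg.2 h2)]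
    -- This equals y - r² x, whose update is exactly subtraction of p n * y.
    set m := (1 - r ^ 2) * y - r ^ 2 * (x - y) with hmdef
    have hstep : (1 - r ^ 2) * heavyBallSol (r ^ 2) p a b (n + 1 + 1)
        - r ^ 2 * (y - heavyBallSol (r ^ 2) p a b (n + 1 + 1)) = m - p n * y := by
      rw [heavyBallSol, ← hy, ← hx, hmdef]
      ring
    -- In the cone m ≤ (1 - r²) y ≤ 2(1 - r) y, so the subtracted term is at least the fraction p n
    -- / (2(1 - r)) of m.
    have hdec : m - p n * y ≤ m * Real.exp (-(p n / (2 * (1 - r)))) := by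
      have h5 : m * (1 - p n / (2 * (1 - r))) ≤ m * Real.exp (-(p n / (2 * (1 - r)))) :=
        mul_le_mul_of_nonneg_left (by linarith [Real.add_one_le_exp (-(p n / (2 * (1 - r))))]) hm
      refine le_trans ?_ h5
      have h6 : m ≤ 2 * (1 - r) * y := hm'.trans (mul_le_mul_of_nonneg_right (by nlinarith) h3)
      have h7 : m / (2 * (1 - r)) ≤ y := by rw [div_le_iff₀ (by linarith)]; linarith
      have h8 := mul_le_mul_of_nonneg_left h7 (hp n)
      calc m - p n * y ≤ m - p n * (m / (2 * (1 - r))) := by linarith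
        _ = _ := by ring
    rw [hstep]
    refine hdec.trans ((mul_le_mul_of_nonneg_right ih (Real.exp_nonneg _)).trans_eq ?_)
    rw [mul_assoc, ← Real.exp_add, Finset.sum_range_succ]
    congr 2
    ring

/-- In the cone the slow variable is at least (1 - r) times the solution; comparing with its initial
bound (1 - r²) b costs only the factor 1 + r ≤ 2. -/
theorem heavyBallSol_le_of_mem_cone (hr : 0 ≤ r) (hr1 : r < 1) (hp : ∀ n, 0 ≤ p n)
    (hp' : ∀ n, p n ≤ (1 - r) ^ 2) {a b : ℝ} (ha : 0 ≤ a) (hab : r * a ≤ b) (hba : b ≤ a) (n : ℕ) :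
    |heavyBallSol (r ^ 2) p a b (n + 1)| ≤
      2 * b * Real.exp (-(∑ i ∈ Finset.range n, p i) / (2 * (1 - r))) := by
  have h := heavyBallSol_slow_le hr hr1 hp hp' ha hab hba n
  obtain ⟨h0, h1, h2⟩ := heavyBallSol_mem_cone hr hp hp' ha hab hba n
  have h3 : 0 ≤ heavyBallSol (r ^ 2) p a b (n + 1) := (mul_nonneg hr h0).trans h1
  rw [abs_of_nonneg h3]
  have hβ : 0 < 1 - r ^ 2 := by nlinarith
  have h4 := mul_le_mul_of_nonneg_left h1 hr
  generalize Real.exp (-(∑ i ∈ Finset.range n, p i) / (2 * (1 - r))) = E at *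
  generalize heavyBallSol (r ^ 2) p a b (n + 1) = y at *
  generalize heavyBallSol (r ^ 2) p a b n = x at *
  have h5 : (1 - r) * y ≤ (1 - r ^ 2) * b * E := by nlinarith
  have h6 : (1 - r ^ 2) * y ≤ (1 - r ^ 2) * (2 * b * E) := by
    have : (1 + r) * ((1 - r) * y) ≤ 2 * ((1 - r) * y) :=
      mul_le_mul_of_nonneg_right (by linarith) (mul_nonneg (by linarith) h3)
    nlinarith
  exact le_of_mul_le_mul_left h6 hβ

/-- An arbitrary state is a combination of the extreme rays (1, 1) and (1, r) of the cone. They are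
nearly parallel for r near 1, whence the factor 1 / (1 - r). -/
theorem heavyBallSol_abs_le_overdamped (hr : 0 ≤ r) (hr1 : r < 1) (hp : ∀ n, 0 ≤ p n)
    (hp' : ∀ n, p n ≤ (1 - r) ^ 2) (a b : ℝ) (n : ℕ) :
    |heavyBallSol (r ^ 2) p a b (n + 1)| ≤
      4 * (|a| + |b|) / (1 - r) *
        Real.exp (-(∑ i ∈ Finset.range n, p i) / (2 * (1 - r))) := by
  have hδ : 0 < 1 - r := sub_pos.2 hr1
  have hP := heavyBallSol_le_of_mem_cone hr hr1 hp hp' zero_le_one (by linarith) le_rfl n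
  have hN := heavyBallSol_le_of_mem_cone hr hr1 hp hp' zero_le_one (mul_one r).le hr1.le n
  have hlin := heavyBallSol_linear (r ^ 2) p ((b - r * a) / (1 - r)) ((a - b) / (1 - r))
    1 1 1 r (n + 1)
  have e1 : (b - r * a) / (1 - r) * 1 + (a - b) / (1 - r) * 1 = a := by field_simp; ring
  have e2 : (b - r * a) / (1 - r) * 1 + (a - b) / (1 - r) * r = b := by field_simp; ring
  rw [e1, e2] at hlin
  rw [hlin]
  generalize heavyBallSol (r ^ 2) p 1 1 (n + 1) = P at *
  generalize heavyBallSol (r ^ 2) p 1 r (n + 1) = N at *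
  have hE := Real.exp_nonneg (-(∑ i ∈ Finset.range n, p i) / (2 * (1 - r)))
  generalize Real.exp (-(∑ i ∈ Finset.range n, p i) / (2 * (1 - r))) = E at *
  have h1 : |b - r * a| ≤ |a| + |b| := by
    have := abs_sub b (r * a)
    rw [abs_mul, abs_of_nonneg hr] at this
    nlinarith [abs_nonneg a]
  have h2 : |a - b| ≤ |a| + |b| := abs_sub a b
  have hN' : |N| ≤ 2 * E := hN.trans (mul_le_mul_of_nonneg_right (by linarith) hE)
  calc |(b - r * a) / (1 - r) * P + (a - b) / (1 - r) * N|
      ≤ |b - r * a| / (1 - r) * |P| + |a - b| / (1 - r) * |N| := by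
        refine (abs_add_le _ _).trans_eq ?_
        rw [abs_mul, abs_mul, abs_div, abs_div, abs_of_pos hδ]
    _ ≤ (|a| + |b|) / (1 - r) * (2 * 1 * E) + (|a| + |b|) / (1 - r) * (2 * E) := by gcongr
    _ = _ := by ring

end Overdamped

/-! ### Underdamped regime: complex characteristic roots. -/

/-- In the underdamped regime the characteristic roots have modulus `r`. -/
theorem heavyBallSol_abs_le_underdamped {r q : ℝ} (hr : 0 ≤ r) (hr1 : r ≤ 1)
    (hq : (1 - r) ^ 2 ≤ q) (hq' : q ≤ (1 + r) ^ 2) (a b : ℝ) (n : ℕ) :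
    |heavyBallSol (r ^ 2) (fun _ => q) a b (n + 1)| ≤ (n + 1) * r ^ n * (|a| + |b|) := by
  set h := (1 + r ^ 2 - q) / 2 with hh
  have hnn : 0 ≤ r ^ 2 - h ^ 2 := by
    have h1 : 0 ≤ (q - (1 - r) ^ 2) * ((1 + r) ^ 2 - q) :=
      mul_nonneg (sub_nonneg.2 hq) (sub_nonneg.2 hq')
    rw [hh]
    nlinarith
  set z : ℂ := ⟨h, √(r ^ 2 - h ^ 2)⟩ with hz
  set y := heavyBallSol (r ^ 2) (fun _ => q) a b with hy
  have hsum : z + (starRingEnd ℂ) z = ((1 + r ^ 2 - q : ℝ) : ℂ) := by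
    rw [Complex.add_conj]
    simp only [hz, hh]
    push_cast
    ring
  have hns : Complex.normSq z = r ^ 2 := by
    simp only [hz, Complex.normSq_mk, Real.mul_self_sqrt hnn]
    ring
  have hprod : z * (starRingEnd ℂ) z = ((r ^ 2 : ℝ) : ℂ) := by
    rw [Complex.mul_conj, hns]
  have hnorm : ‖z‖ = r := by
    rw [Complex.norm_def, hns, Real.sqrt_sq hr]
  -- Factoring out the root z leaves a first-order recurrence with multiplier conj z. Undoing the
  -- factorisation sums n + 1 terms of size rⁿ, and stays valid for a double root.
  have hD : ∀ n, ‖(y (n + 1) : ℂ) - z * y n‖ ≤ r ^ n * (|a| + |b|) := by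
    intro n
    induction n with
    | zero =>
      refine (norm_sub_le _ _).trans ?_
      rw [norm_mul, hnorm, Complex.norm_real, Complex.norm_real, Real.norm_eq_abs, Real.norm_eq_abs]
      change |b| + r * |a| ≤ _
      nlinarith [abs_nonneg a]
    | succ n ih =>
      have : (y (n + 1 + 1) : ℂ) - z * y (n + 1) = (starRingEnd ℂ) z * (y (n + 1) - z * y n) := by
        have e : y (n + 1 + 1) = (1 + r ^ 2 - q) * y (n + 1) - r ^ 2 * y n := rfl
        rw [e, Complex.ofReal_sub, Complex.ofReal_mul, Complex.ofReal_mul, ← hsum, ← hprod]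
        ring
      rw [this, norm_mul, Complex.norm_conj, hnorm, pow_succ']
      rw [mul_assoc]
      exact mul_le_mul_of_nonneg_left ih hr
  induction n with
  | zero =>
    have : y (0 + 1) = b := rfl
    rw [this]
    simp
  | succ n ih =>
    have h1 := hD (n + 1)
    have h2 : |y (n + 1 + 1)| ≤ r ^ (n + 1) * (|a| + |b|) + r * |y (n + 1)| := by
      have := norm_add_le ((y (n + 1 + 1) : ℂ) - z * y (n + 1)) (z * y (n + 1))
      rw [sub_add_cancel, norm_mul, hnorm, Complex.norm_real, Complex.norm_real] at this
      exact this.trans (add_le_add_left h1 _)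
    have h3 := mul_le_mul_of_nonneg_left ih hr
    refine h2.trans ((add_le_add_right h3 _).trans_eq ?_)
    push_cast
    ring

/-- The exponent is that of the earlier of the two entries; at n = 0 truncated subtraction makes the
power 1. -/
theorem heavyBallSol_state_le_underdamped {r q : ℝ} (hr : 0 ≤ r) (hr1 : r ≤ 1)
    (hq : (1 - r) ^ 2 ≤ q) (hq' : q ≤ (1 + r) ^ 2) (a b : ℝ) (n : ℕ) :
    |heavyBallSol (r ^ 2) (fun _ => q) a b n| + |heavyBallSol (r ^ 2) (fun _ => q) a b (n + 1)| ≤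
      2 * (n + 1) * r ^ (n - 1) * (|a| + |b|) := by
  have hS : 0 ≤ |a| + |b| := by positivity
  have h1 := heavyBallSol_abs_le_underdamped hr hr1 hq hq' a b n
  cases n with
  | zero =>
    simp only [heavyBallSol, Nat.cast_zero, zero_le, Nat.sub_eq_zero_of_le, pow_zero]
    linarith
  | succ n =>
    have h2 := heavyBallSol_abs_le_underdamped hr hr1 hq hq' a b n
    have h3 : r ^ (n + 1) ≤ r ^ n := pow_le_pow_of_le_one hr hr1 (Nat.le_succ n)
    have h4 : ((n : ℝ) + 1) * r ^ n * (|a| + |b|) ≤ (n + 2) * r ^ n * (|a| + |b|) := by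
      gcongr; norm_num
    have h5 : ((n : ℝ) + 2) * r ^ (n + 1) * (|a| + |b|) ≤ (n + 2) * r ^ n * (|a| + |b|) := by
      gcongr
    push_cast at h1 ⊢
    linarith

theorem Real.mul_exp_neg_le_one (x : ℝ) : x * Real.exp (-x) ≤ 1 := by
  have h := mul_le_mul_of_nonneg_right (by linarith [Real.add_one_le_exp x] : x ≤ Real.exp x)
    (Real.exp_nonneg (-x))
  rwa [← Real.exp_add, add_neg_cancel, Real.exp_zero] at h

/-! ### Stages of the step size schedule and numerical consequences of A ≤ T. -/

/-- The length of a stage of the step size schedule. -/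
noncomputable def stageLength (T : ℕ) : ℝ := T / Real.logb 2 T

/-- The first step of stage `l` (counted from `0`) of the step size schedule. -/
noncomputable def stageStart (T l : ℕ) : ℕ := ⌈l * stageLength T⌉₊

/-- The index (counted from `0`) of the stage that contains step `t`. -/
noncomputable def stageIndex (T t : ℕ) : ℕ := ⌊t / stageLength T⌋₊

theorem stepSize_eq (q : ℝ) (T t : ℕ) : stepSize q T t = q / 4 ^ stageIndex T t := rfl

theorem mul_stepSize (x q : ℝ) (T t : ℕ) : x * stepSize q T t = stepSize (x * q) T t := by
  rw [stepSize_eq, stepSize_eq, mul_div_assoc]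

/-- The parameters of the heavy ball method along one eigenvector: `T` steps, momentum `r ^ 2`,
and initial step size times eigenvalue `q`. -/
structure HeavyBallParams (T : ℕ) (r q : ℝ) : Prop where
  sixteen_le : 16 ≤ T
  momentumA_le : momentumA T ≤ T
  nonneg : 0 ≤ r
  le_one_sub : r ≤ 1 - momentumA T / T
  step_nonneg : 0 ≤ q
  step_le_one : q ≤ 1

namespace HeavyBallParams

variable {T : ℕ} {r q : ℝ}

theorem sixteen_le_cast (h : HeavyBallParams T r q) : (16 : ℝ) ≤ T := by
  exact_mod_cast h.sixteen_le

theorem four_le_logb (h : HeavyBallParams T r q) : 4 ≤ Real.logb 2 T := by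
  have hT := h.sixteen_le_cast
  rw [Real.le_logb_iff_rpow_le (by norm_num) (by linarith)]
  norm_num
  exact h.sixteen_le

theorem two_le_log (h : HeavyBallParams T r q) : 2 ≤ Real.log T := by
  have hT := h.sixteen_le_cast
  have h1 : Real.log 16 ≤ Real.log T := Real.log_le_log (by norm_num) hT
  have h2 : Real.log 16 = 4 * Real.log 2 := by
    rw [show (16 : ℝ) = 2 ^ 4 by norm_num, Real.log_pow]
    norm_num
  linarith [Real.log_two_gt_d9]

theorem logb_le_momentumA (h : HeavyBallParams T r q) : Real.logb 2 T ≤ momentumA T := by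
  rw [momentumA]
  nlinarith [h.four_le_logb, h.two_le_log]

theorem log_le_stageLength (h : HeavyBallParams T r q) : 256 * Real.log T ≤ stageLength T := by
  rw [stageLength, le_div_iff₀ (by linarith [h.four_le_logb])]
  have := h.momentumA_le
  rw [momentumA] at this
  linarith

theorem stageLength_pos (h : HeavyBallParams T r q) : 0 < stageLength T := by
  linarith [h.log_le_stageLength, h.two_le_log]

theorem momentumA_le_mul (h : HeavyBallParams T r q) : momentumA T ≤ (1 - r) * T := by
  have hT := h.sixteen_le_cast
  rw [← div_le_iff₀ (by linarith)]
  linarith [h.le_one_sub]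

theorem log_le_mul_stageLength (h : HeavyBallParams T r q) :
    256 * Real.log T ≤ (1 - r) * stageLength T := by
  rw [stageLength, ← mul_div_assoc, le_div_iff₀ (by linarith [h.four_le_logb])]
  have := h.momentumA_le_mul
  rw [momentumA] at this
  linarith

theorem sixteen_le_mul (h : HeavyBallParams T r q) : 16 ≤ (1 - r) * T := by
  have := h.momentumA_le_mul
  rw [momentumA] at this
  nlinarith [h.four_le_logb, h.two_le_log]

theorem one_sub_pos (h : HeavyBallParams T r q) : 0 < 1 - r := by
  have := h.sixteen_le_mul
  have hT := h.sixteen_le_cast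
  by_contra hn
  nlinarith

theorem lt_one (h : HeavyBallParams T r q) : r < 1 := by
  linarith [h.one_sub_pos]

theorem exp_neg_le (h : HeavyBallParams T r q) {x : ℝ} (hx : 16 * Real.log T ≤ x) :
    Real.exp (-x) ≤ 1 / T ^ 16 := by
  have hT := h.sixteen_le_cast
  calc Real.exp (-x) ≤ Real.exp (-(16 * Real.log T)) := Real.exp_le_exp.2 (neg_le_neg hx)
    _ = 1 / T ^ 16 := by
      rw [Real.exp_neg, one_div, show (16 : ℝ) = ((16 : ℕ) : ℝ) by norm_num, Real.exp_nat_mul,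
        Real.exp_log (by linarith)]

theorem stageStart_le_iff (h : HeavyBallParams T r q) (l t : ℕ) :
    stageStart T l ≤ t ↔ l ≤ stageIndex T t := by
  have hK := h.stageLength_pos
  rw [stageStart, stageIndex, Nat.ceil_le, Nat.le_floor_iff (by positivity), le_div_iff₀ hK]

theorem stageIndex_eq (h : HeavyBallParams T r q) {l t : ℕ} (h1 : stageStart T l ≤ t)
    (h2 : t < stageStart T (l + 1)) : stageIndex T t = l := by
  have h3 := (h.stageStart_le_iff l t).1 h1
  have h4 := mt (h.stageStart_le_iff (l + 1) t).2 (not_le.2 h2)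
  omega

theorem lt_stageStart_succ (h : HeavyBallParams T r q) (t : ℕ) :
    t < stageStart T (stageIndex T t + 1) := by
  rw [← not_le, h.stageStart_le_iff]
  omega

theorem stageStart_le_of_le_logb (h : HeavyBallParams T r q) {l : ℕ} (hl : (l : ℝ) ≤ Real.logb 2 T) :
    stageStart T l ≤ T := by
  have hL := h.four_le_logb
  rw [stageStart, Nat.ceil_le, stageLength, ← mul_div_assoc, div_le_iff₀ (by linarith), mul_comm]
  exact mul_le_mul_of_nonneg_left hl (Nat.cast_nonneg T)

theorem stageStart_zero (T : ℕ) : stageStart T 0 = 0 := by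
  simp [stageStart]

/-- Rounding costs a stage less than one step, and K ≥ 512. The extra 1 pays for the exponent n - 1
in the underdamped bound. -/
theorem stageStart_add_le (h : HeavyBallParams T r q) (l : ℕ) :
    stageStart T l + (stageLength T / 2 + 1) ≤ stageStart T (l + 1) := by
  have hK := h.stageLength_pos
  have h1 := h.log_le_stageLength
  have h2 := h.two_le_log
  have h3 : (stageStart T l : ℝ) < l * stageLength T + 1 :=
    Nat.ceil_lt_add_one (by positivity)
  have h4 : ((l + 1 : ℕ) : ℝ) * stageLength T ≤ stageStart T (l + 1) := Nat.le_ceil _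
  push_cast at h4
  linarith

theorem stageStart_le_succ (h : HeavyBallParams T r q) (l : ℕ) :
    stageStart T l ≤ stageStart T (l + 1) := by
  have h1 := h.stageStart_add_le l
  have h2 := h.stageLength_pos
  have : (stageStart T l : ℝ) ≤ stageStart T (l + 1) := by linarith
  exact_mod_cast this

theorem stepSize_nonneg (h : HeavyBallParams T r q) (t : ℕ) : 0 ≤ stepSize q T t := by
  have := h.step_nonneg
  rw [stepSize_eq]
  positivity

theorem stepSize_antitone (h : HeavyBallParams T r q) : Antitone (stepSize q T) := by
  intro s t hst
  have hK := h.stageLength_pos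
  rw [stepSize_eq, stepSize_eq]
  have h1 : stageIndex T s ≤ stageIndex T t := by
    unfold stageIndex
    gcongr
  exact div_le_div_of_nonneg_left h.step_nonneg (by positivity)
    (pow_le_pow_right₀ (by norm_num) h1)

theorem stepSize_le (h : HeavyBallParams T r q) (t : ℕ) : stepSize q T t ≤ q := by
  rw [stepSize_eq]
  exact div_le_self h.step_nonneg (one_le_pow₀ (by norm_num))

theorem stepSize_stageStart (h : HeavyBallParams T r q) (l : ℕ) :
    stepSize q T (stageStart T l) = q / 4 ^ l := by
  rw [stepSize_eq, h.stageIndex_eq le_rfl]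
  have h1 := h.stageStart_add_le l
  have h2 := h.stageLength_pos
  have : (stageStart T l : ℝ) < stageStart T (l + 1) := by linarith
  exact_mod_cast this

/-- The step size of a stage that starts at most two stage lengths before the end is tiny. -/
theorem div_four_pow_le (h : HeavyBallParams T r q) {l : ℕ} (hl : Real.logb 2 T < l + 2) :
    q / 4 ^ l ≤ 16 / (T : ℝ) ^ 2 := by
  have hT := h.sixteen_le_cast
  have h1 : (T : ℝ) ≤ 2 ^ (l + 2) := by
    have : (T : ℝ) < (2 : ℝ) ^ ((l : ℝ) + 2) := (Real.logb_lt_iff_lt_rpow (by norm_num)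
      (by linarith)).1 hl
    rw [show (l : ℝ) + 2 = ((l + 2 : ℕ) : ℝ) by push_cast; ring, Real.rpow_natCast] at this
    exact this.le
  have h2 : (T : ℝ) ^ 2 ≤ 16 * 4 ^ l := by
    calc (T : ℝ) ^ 2 ≤ (2 ^ (l + 2)) ^ 2 := by gcongr
      _ = 16 * 4 ^ l := by
        rw [← pow_mul, mul_comm, pow_mul, pow_add]
        norm_num
        ring
  rw [div_le_div_iff₀ (by positivity) (by positivity)]
  nlinarith [h.step_le_one, sq_nonneg (T : ℝ)]

/-- With `div_four_pow_le`, this shows that a stage without a full successor is never underdamped.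
-/
theorem div_sq_le (h : HeavyBallParams T r q) : 16 / (T : ℝ) ^ 2 ≤ (1 - r) ^ 2 / 4 := by
  have hT := h.sixteen_le_cast
  rw [div_le_div_iff₀ (by positivity) (by norm_num), ← mul_pow]
  nlinarith [h.sixteen_le_mul]

theorem le_sum_stepSize (h : HeavyBallParams T r q) {s l : ℕ} (hs : s ≤ stageStart T l)
    (hl : (l + 1 : ℝ) ≤ Real.logb 2 T) :
    stageLength T / 2 * (q / 4 ^ l) ≤ ∑ i ∈ Finset.range (T - s), stepSize q T (s + i) := by
  have hq := h.step_nonneg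
  have h1 : stageStart T (l + 1) ≤ T := h.stageStart_le_of_le_logb (by exact_mod_cast hl)
  have h2 := h.stageStart_add_le l
  calc stageLength T / 2 * (q / 4 ^ l)
      ≤ ((stageStart T (l + 1) : ℝ) - stageStart T l) * (q / 4 ^ l) :=
        mul_le_mul_of_nonneg_right (by linarith) (by positivity)
    _ = ∑ _t ∈ Finset.Ico (stageStart T l) (stageStart T (l + 1)), q / 4 ^ l := by
        rw [Finset.sum_const, Nat.card_Ico, nsmul_eq_mul, Nat.cast_sub (h.stageStart_le_succ l)]
    _ = ∑ t ∈ Finset.Ico (stageStart T l) (stageStart T (l + 1)), stepSize q T t := by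
        refine Finset.sum_congr rfl fun t ht => ?_
        rw [Finset.mem_Ico] at ht
        rw [stepSize_eq, h.stageIndex_eq ht.1 ht.2]
    _ ≤ ∑ t ∈ Finset.Ico s T, stepSize q T t :=
        Finset.sum_le_sum_of_subset_of_nonneg (Finset.Ico_subset_Ico hs h1)
          fun t _ _ => h.stepSize_nonneg t
    _ = _ := Finset.sum_Ico_eq_sum_range _ _ _

/-! ### Contraction across stages. -/

theorem state_le_of_underdamped (h : HeavyBallParams T r q) {l s : ℕ} (hs : stageStart T l ≤ s)
    (hs' : s ≤ stageStart T (l + 1)) (hl : (1 - r) ^ 2 ≤ q / 4 ^ l) (a b : ℝ) :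
    |heavyBallSol (r ^ 2) (fun i => stepSize q T (s + i)) a b (stageStart T (l + 1) - s)|
      + |heavyBallSol (r ^ 2) (fun i => stepSize q T (s + i)) a b (stageStart T (l + 1) - s + 1)| ≤
      2 * ((stageStart T (l + 1) - s : ℕ) + 1) * r ^ (stageStart T (l + 1) - s - 1)
        * (|a| + |b|) := by
  have hc : ∀ i < stageStart T (l + 1) - s, stepSize q T (s + i) = q / 4 ^ l := fun i hi => by
    rw [stepSize_eq, h.stageIndex_eq (l := l) (by omega) (by omega)]
  rw [heavyBallSol_congr a b hc _ (Nat.le_succ _), heavyBallSol_congr a b hc _ le_rfl]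
  refine heavyBallSol_state_le_underdamped h.nonneg h.lt_one.le hl ?_ a b _
  have h1 : q / 4 ^ l ≤ q := div_le_self h.step_nonneg (one_le_pow₀ (by norm_num))
  nlinarith [h.nonneg, h.step_le_one]

theorem sol_add_stage {l s : ℕ} (hs' : s ≤ stageStart T (l + 1))
    (hl : stageStart T (l + 1) ≤ T) (a b : ℝ) :
    heavyBallSol (r ^ 2) (fun i => stepSize q T (s + i)) a b (T - s + 1) =
      heavyBallSol (r ^ 2) (fun i => stepSize q T (stageStart T (l + 1) + i))
        (heavyBallSol (r ^ 2) (fun i => stepSize q T (s + i)) a b (stageStart T (l + 1) - s))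
        (heavyBallSol (r ^ 2) (fun i => stepSize q T (s + i)) a b (stageStart T (l + 1) - s + 1))
        (T - stageStart T (l + 1) + 1) := by
  have e : T - s + 1 = (stageStart T (l + 1) - s) + (T - stageStart T (l + 1) + 1) := by omega
  rw [e, heavyBallSol_add]
  congr 1
  ext i
  congr 1
  omega

theorem abs_sol_le_overdamped (h : HeavyBallParams T r q) {s l : ℕ} (hs : s ≤ stageStart T l)
    (hl : (l + 1 : ℝ) ≤ Real.logb 2 T) (hq : stepSize q T s ≤ (1 - r) ^ 2) (a b : ℝ) :
    |heavyBallSol (r ^ 2) (fun i => stepSize q T (s + i)) a b (T - s + 1)| ≤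
      4 * (|a| + |b|) / (1 - r) *
        Real.exp (-(stageLength T * (q / 4 ^ l) / (4 * (1 - r)))) := by
  have hδ := h.one_sub_pos
  refine (heavyBallSol_abs_le_overdamped h.nonneg h.lt_one (fun n => h.stepSize_nonneg _)
    (fun n => (h.stepSize_antitone (Nat.le_add_right s n)).trans hq) a b (T - s)).trans ?_
  have h1 := h.le_sum_stepSize hs hl
  refine mul_le_mul_of_nonneg_left (Real.exp_le_exp.2 ?_) (by positivity)
  rw [neg_div, neg_le_neg_iff, div_le_div_iff₀ (by positivity) (by positivity)]
  nlinarith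

/-- From the start of a full stage whose step size is not small compared with `(1 - r) ^ 2`, the
method contracts by a large power of `T`. -/
theorem abs_sol_stageStart_le (h : HeavyBallParams T r q) (N : ℕ) :
    ∀ l : ℕ, Real.logb 2 T ≤ l + N → (l + 1 : ℝ) ≤ Real.logb 2 T →
      (1 - r) ^ 2 / 4 < q / 4 ^ l → ∀ a b : ℝ,
      |heavyBallSol (r ^ 2) (fun i => stepSize q T (stageStart T l + i)) a b
        (T - stageStart T l + 1)| ≤ (|a| + |b|) / T ^ 8 := by
  have hT := h.sixteen_le_cast
  have hδ := h.one_sub_pos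
  have hlog := h.two_le_log
  have hδK := h.log_le_mul_stageLength
  have hK := h.stageLength_pos
  induction N with
  | zero =>
    intro l h1 h2
    push_cast at h1
    linarith
  | succ N ih =>
    intro l h1 h2 h3 a b
    have hS : 0 ≤ |a| + |b| := by positivity
    by_cases hq : q / 4 ^ l ≤ (1 - r) ^ 2
    · refine (h.abs_sol_le_overdamped le_rfl h2 (by rwa [h.stepSize_stageStart]) a b).trans ?_
      -- The coefficient exceeds (1 - r)²/4, so the exponent is at least (1 - r)K/16 ≥ 16 ln T; this
      -- is where the 256 in A is spent.
      have h4 : Real.exp (-(stageLength T * (q / 4 ^ l) / (4 * (1 - r)))) ≤ 1 / T ^ 16 := by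
        refine h.exp_neg_le ?_
        rw [le_div_iff₀ (by positivity)]
        have h5 : stageLength T * ((1 - r) ^ 2 / 4) ≤ stageLength T * (q / 4 ^ l) :=
          mul_le_mul_of_nonneg_left h3.le hK.le
        nlinarith
      have h6 : 4 / (1 - r) ≤ T := by
        rw [div_le_iff₀ hδ]
        linarith [h.sixteen_le_mul]
      calc 4 * (|a| + |b|) / (1 - r) * Real.exp (-(stageLength T * (q / 4 ^ l) / (4 * (1 - r))))
          = (|a| + |b|) * (4 / (1 - r) *
              Real.exp (-(stageLength T * (q / 4 ^ l) / (4 * (1 - r))))) := by ring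
        _ ≤ (|a| + |b|) * (T * (1 / T ^ 16)) := by gcongr
        _ = (|a| + |b|) * (1 / T ^ 15) := by field_simp
        _ ≤ (|a| + |b|) * (1 / T ^ 8) := by
          gcongr
          · linarith
          · norm_num
        _ = _ := by ring
    -- An underdamped stage is followed by another full stage, whose coefficient, four times
    -- smaller, still exceeds (1 - r)²/4; the induction applies there.
    · push Not at hq
      have h4 : (l : ℝ) + 2 ≤ Real.logb 2 T := by
        by_contra hn
        have := h.div_four_pow_le (not_le.1 hn)
        have := h.div_sq_le
        nlinarith
      have h5 : stageStart T (l + 1) ≤ T := h.stageStart_le_of_le_logb (by push_cast; linarith)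
      rw [sol_add_stage (h.stageStart_le_succ l) h5]
      refine (ih (l + 1) (by push_cast at h1 ⊢; linarith) (by push_cast; linarith)
        (by rw [pow_succ (4 : ℝ), ← div_div]; linarith) _ _).trans ?_
      refine div_le_div_of_nonneg_right ((h.state_le_of_underdamped le_rfl (h.stageStart_le_succ l)
        hq.le a b).trans ?_) (by positivity)
      have h6 : 2 * (((stageStart T (l + 1) - stageStart T l : ℕ) : ℝ) + 1) ≤ 4 * T := by
        have : stageStart T (l + 1) - stageStart T l ≤ T := by omega
        have : ((stageStart T (l + 1) - stageStart T l : ℕ) : ℝ) ≤ T := by exact_mod_cast this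
        linarith
      have h7 : r ^ (stageStart T (l + 1) - stageStart T l - 1) ≤ 1 / T ^ 16 := by
        have h8 : r ≤ Real.exp (-(1 - r)) := by linarith [Real.add_one_le_exp (-(1 - r))]
        refine (pow_le_pow_left₀ h.nonneg h8 _).trans ?_
        rw [← Real.exp_nat_mul, mul_neg]
        refine h.exp_neg_le ?_
        have h9 := h.stageStart_add_le l
        have h10 : stageLength T / 2 ≤ (stageStart T (l + 1) - stageStart T l - 1 : ℕ) := by
          have : stageStart T (l + 1) ≤
            stageStart T l + ((stageStart T (l + 1) - stageStart T l - 1) + 1) := by omega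
          have : (stageStart T (l + 1) : ℝ) ≤
            stageStart T l + (((stageStart T (l + 1) - stageStart T l - 1 : ℕ) : ℝ) + 1) := by
            exact_mod_cast this
          linarith
        nlinarith [mul_le_mul_of_nonneg_right h10 hδ.le]
      -- The underdamped stage need only be non-expanding: the power of T comes from the later
      -- overdamped stage.
      calc 2 * (((stageStart T (l + 1) - stageStart T l : ℕ) : ℝ) + 1)
            * r ^ (stageStart T (l + 1) - stageStart T l - 1) * (|a| + |b|)
          ≤ 4 * T * (1 / T ^ 16) * (|a| + |b|) := by
            have := pow_nonneg h.nonneg (stageStart T (l + 1) - stageStart T l - 1)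
            gcongr
        _ ≤ 1 * (|a| + |b|) := by
            gcongr
            have : (4 : ℝ) ≤ T ^ 15 := by
              calc (4 : ℝ) ≤ 16 ^ 15 := by norm_num
                _ ≤ T ^ 15 := by gcongr
            rw [mul_one_div, div_le_one (by positivity)]
            nlinarith
        _ = _ := one_mul _

theorem abs_sol_stageStart_le' (h : HeavyBallParams T r q) {l : ℕ}
    (hl : (l + 1 : ℝ) ≤ Real.logb 2 T) (hq : (1 - r) ^ 2 / 4 < q / 4 ^ l) (a b : ℝ) :
    |heavyBallSol (r ^ 2) (fun i => stepSize q T (stageStart T l + i)) a b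
        (T - stageStart T l + 1)| ≤ (|a| + |b|) / T ^ 8 := by
  obtain ⟨N, hN⟩ := exists_nat_ge (Real.logb 2 T)
  exact h.abs_sol_stageStart_le N l (by linarith [(Nat.cast_nonneg l : (0 : ℝ) ≤ l)]) hl hq a b

/-! ### Bias and noise response along one eigenvector. -/

/-- The bias along an eigenvector. -/
theorem mul_sq_bias_le (h : HeavyBallParams T r q) (a : ℝ) :
    q * heavyBallSol (r ^ 2) (stepSize q T) a a (T + 1) ^ 2 ≤
      8 * (Real.logb 2 T * (1 - r) / T) * a ^ 2 := by
  have hT := h.sixteen_le_cast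
  have hδ := h.one_sub_pos
  have hL := h.four_le_logb
  have hK := h.stageLength_pos
  have hq := h.step_nonneg
  by_cases hc : q ≤ (1 - r) ^ 2
  · have hlin := heavyBallSol_linear (r ^ 2) (stepSize q T) a 0 1 1 1 1 (T + 1)
    simp only [mul_one, zero_mul, add_zero] at hlin
    -- The initial state (a, a) lies on a ray of the cone, so no factor 1 / (1 - r) is lost. Stage 0
    -- alone supplies the decay.
    have h1 := heavyBallSol_le_of_mem_cone h.nonneg h.lt_one h.stepSize_nonneg
      (fun n => (h.stepSize_le n).trans hc) zero_le_one (by linarith [h.lt_one]) le_rfl T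
    have h2 := h.le_sum_stepSize (s := 0) (l := 0) (Nat.zero_le _) (by push_cast; linarith)
    simp only [pow_zero, div_one, tsub_zero, zero_add] at h2
    rw [hlin, mul_pow]
    set Y := heavyBallSol (r ^ 2) (stepSize q T) 1 1 (T + 1)
    have h3 : |Y| ≤ 2 * Real.exp (-(stageLength T * q / (4 * (1 - r)))) := by
      refine h1.trans ?_
      rw [mul_one]
      refine mul_le_mul_of_nonneg_left (Real.exp_le_exp.2 ?_) zero_le_two
      rw [neg_div, neg_le_neg_iff, div_le_div_iff₀ (by positivity) (by positivity)]
      nlinarith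
    have h4 : Y ^ 2 ≤ 4 * Real.exp (-(stageLength T * q / (2 * (1 - r)))) := by
      rw [← sq_abs]
      refine (pow_le_pow_left₀ (abs_nonneg _) h3 2).trans_eq ?_
      rw [mul_pow, ← Real.exp_nat_mul]
      congr 1
      · norm_num
      · congr 1
        push_cast
        field_simp
        ring
    have h5 := Real.mul_exp_neg_le_one (stageLength T * q / (2 * (1 - r)))
    have h6 : q * Y ^ 2 ≤ 8 * (Real.logb 2 T * (1 - r) / T) := by
      calc q * Y ^ 2 ≤ q * (4 * Real.exp (-(stageLength T * q / (2 * (1 - r))))) := by gcongr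
        _ = 8 * (1 - r) / stageLength T * (stageLength T * q / (2 * (1 - r)) *
              Real.exp (-(stageLength T * q / (2 * (1 - r))))) := by
            field_simp
            ring
        _ ≤ 8 * (1 - r) / stageLength T * 1 := by gcongr
        _ = _ := by
          rw [stageLength]
          field_simp
    calc q * (a ^ 2 * Y ^ 2) = q * Y ^ 2 * a ^ 2 := by ring
      _ ≤ _ := mul_le_mul_of_nonneg_right h6 (sq_nonneg a)
  · have h1 := h.abs_sol_stageStart_le' (l := 0) (by push_cast; linarith)
      (by simp only [pow_zero, div_one]; nlinarith) a a
    simp only [stageStart_zero, tsub_zero, zero_add] at h1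
    set Y := heavyBallSol (r ^ 2) (stepSize q T) a a (T + 1)
    have h2 : Y ^ 2 ≤ 4 * a ^ 2 / T ^ 16 := by
      rw [← sq_abs]
      refine (pow_le_pow_left₀ (abs_nonneg _) h1 2).trans_eq ?_
      rw [div_pow, ← two_mul, mul_pow, sq_abs, ← pow_mul]
      norm_num
    have h3 : 4 / (T : ℝ) ^ 16 ≤ 8 * (Real.logb 2 T * (1 - r) / T) := by
      have h4 := h.sixteen_le_mul
      calc 4 / (T : ℝ) ^ 16 ≤ 4 / (T : ℝ) ^ 2 := by
            gcongr
            · linarith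
            · norm_num
        _ ≤ 8 * (Real.logb 2 T * (1 - r) / T) := by
            rw [← mul_div_assoc, div_le_div_iff₀ (by positivity) (by linarith)]
            have h5 : 4 * 16 ≤ Real.logb 2 T * ((1 - r) * T) := by gcongr
            nlinarith
    calc q * Y ^ 2 ≤ 1 * (4 * a ^ 2 / T ^ 16) := by
          gcongr
          exact h.step_le_one
      _ = 4 / T ^ 16 * a ^ 2 := by ring
      _ ≤ _ := mul_le_mul_of_nonneg_right h3 (sq_nonneg a)

/-- The response at the last iterate to noise injected at step `t`. -/
theorem mul_abs_response_le (h : HeavyBallParams T r q) {t : ℕ} (ht : t < T) :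
    stepSize q T t *
        |heavyBallSol (r ^ 2) (fun i => stepSize q T (t + 1 + i)) 0 1 (T - t)| ≤
      64 * Real.logb 2 T / T := by
  have hT := h.sixteen_le_cast
  have hδ := h.one_sub_pos
  have hL := h.four_le_logb
  have hK := h.stageLength_pos
  have hq := h.stepSize_nonneg t
  have e : T - t = T - (t + 1) + 1 := by omega
  rw [e]
  set l := stageIndex T t with hl
  have hql : stepSize q T t = q / 4 ^ l := stepSize_eq q T t
  have hts : t + 1 ≤ stageStart T (l + 1) := h.lt_stageStart_succ t
  by_cases hc : stepSize q T t ≤ (1 - r) ^ 2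
  · by_cases hfull : (l : ℝ) + 2 ≤ Real.logb 2 T
    -- The rest of the current stage may be empty, so decay is taken from the next one, with
    -- coefficient x / 4. The factor 4 / (1 - r) and the exponent Kx / (16(1 - r)) give 64 / K.
    · have h1 := h.abs_sol_le_overdamped hts (by push_cast; linarith)
        ((h.stepSize_antitone (Nat.le_succ t)).trans hc) 0 1
      rw [pow_succ (4 : ℝ), ← div_div q, ← hql, abs_zero, abs_one, zero_add, mul_one] at h1
      set x := stepSize q T t
      have h2 := Real.mul_exp_neg_le_one (stageLength T * (x / 4) / (4 * (1 - r)))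
      calc x * _ ≤ x * (4 / (1 - r) *
            Real.exp (-(stageLength T * (x / 4) / (4 * (1 - r))))) := by gcongr
        _ = 64 / stageLength T * (stageLength T * (x / 4) / (4 * (1 - r)) *
            Real.exp (-(stageLength T * (x / 4) / (4 * (1 - r))))) := by
          field_simp
          ring
        _ ≤ 64 / stageLength T * 1 := by gcongr
        _ = _ := by
          rw [stageLength]
          field_simp
    -- Near the end no full stage may remain, but the step is at most 16 / T², which beats the
    -- undamped response 4 / (1 - r) ≤ T.
    · have h1 := heavyBallSol_abs_le_overdamped h.nonneg h.lt_one
        (p := fun i => stepSize q T (t + 1 + i)) (fun n => h.stepSize_nonneg _)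
        (fun n => (h.stepSize_antitone (by omega : t ≤ t + 1 + n)).trans hc) 0 1 (T - (t + 1))
      have h2 : Real.exp (-(∑ i ∈ Finset.range (T - (t + 1)), stepSize q T (t + 1 + i))
          / (2 * (1 - r))) ≤ 1 := by
        rw [Real.exp_le_one_iff, neg_div, neg_nonpos]
        exact div_nonneg (Finset.sum_nonneg fun i _ => h.stepSize_nonneg _) (by positivity)
      have h3 : 4 * (|(0 : ℝ)| + |1|) / (1 - r) ≤ T := by
        rw [abs_zero, abs_one, div_le_iff₀ hδ]
        linarith [h.sixteen_le_mul]
      have h4 := h1.trans (mul_le_mul h3 h2 (Real.exp_nonneg _) (Nat.cast_nonneg T))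
      have h5 := h.div_four_pow_le (not_le.1 hfull)
      rw [hql]
      calc q / 4 ^ l * _ ≤ 16 / (T : ℝ) ^ 2 * (T * 1) := by gcongr
        _ = 16 / T := by field_simp
        _ ≤ _ := by gcongr; linarith
  -- The remainder of the underdamped stage may grow the state to 4T; the T⁻⁸ gained from the next
  -- stage onwards absorbs this.
  · push Not at hc
    have hfull : (l : ℝ) + 2 ≤ Real.logb 2 T := by
      by_contra hn
      have := h.div_four_pow_le (not_le.1 hn)
      have := h.div_sq_le
      nlinarith
    have h5 : stageStart T (l + 1) ≤ T := h.stageStart_le_of_le_logb (by push_cast; linarith)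
    rw [sol_add_stage hts h5]
    have h1 := h.abs_sol_stageStart_le' (l := l + 1) (by push_cast; linarith)
      (by rw [pow_succ (4 : ℝ), ← div_div, ← hql]; linarith)
      (heavyBallSol (r ^ 2) (fun i => stepSize q T (t + 1 + i)) 0 1 (stageStart T (l + 1) - (t + 1)))
      (heavyBallSol (r ^ 2) (fun i => stepSize q T (t + 1 + i)) 0 1
        (stageStart T (l + 1) - (t + 1) + 1))
    have h2 := h.state_le_of_underdamped (l := l) (s := t + 1)
      (((h.stageStart_le_iff l t).2 le_rfl).trans (Nat.le_succ t)) hts (hql ▸ hc.le) 0 1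
    have h3 : 2 * (((stageStart T (l + 1) - (t + 1) : ℕ) : ℝ) + 1)
        * r ^ (stageStart T (l + 1) - (t + 1) - 1) * (|0| + |1|) ≤ 4 * T := by
      have h6 : stageStart T (l + 1) - (t + 1) ≤ T := by omega
      have h7 : ((stageStart T (l + 1) - (t + 1) : ℕ) : ℝ) ≤ T := by exact_mod_cast h6
      have h8 : r ^ (stageStart T (l + 1) - (t + 1) - 1) ≤ 1 :=
        pow_le_one₀ h.nonneg h.lt_one.le
      have h9 := mul_le_mul (by linarith : 2 * (((stageStart T (l + 1) - (t + 1) : ℕ) : ℝ) + 1)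
        ≤ 4 * T) h8 (pow_nonneg h.nonneg _) (by positivity)
      rw [abs_zero, abs_one]
      linarith
    have h4 := h1.trans (div_le_div_of_nonneg_right (h2.trans h3) (by positivity))
    have h6 : stepSize q T t ≤ 1 := (h.stepSize_le t).trans h.step_le_one
    calc _ ≤ 1 * (4 * T / (T : ℝ) ^ 8) := by gcongr
      _ = 4 / (T : ℝ) ^ 7 := by field_simp
      _ ≤ 4 / (T : ℝ) ^ 1 := by
        gcongr
        · linarith
        · norm_num
      _ ≤ _ := by
        rw [pow_one]
        gcongr
        linarith

/-- The variance along an eigenvector. -/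
theorem sum_sq_response_le (h : HeavyBallParams T r q) :
    ∑ t ∈ Finset.range T, (stepSize q T t *
        heavyBallSol (r ^ 2) (fun i => stepSize q T (t + 1 + i)) 0 1 (T - t)) ^ 2 ≤
      4096 * (momentumA T ^ 2 / T) := by
  have hT := h.sixteen_le_cast
  have hL := h.four_le_logb
  calc _ ≤ ∑ _t ∈ Finset.range T, (64 * Real.logb 2 T / T) ^ 2 := by
        refine Finset.sum_le_sum fun t ht => ?_
        rw [← sq_abs, abs_mul, abs_of_nonneg (h.stepSize_nonneg t)]
        have := h.stepSize_nonneg t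
        exact pow_le_pow_left₀ (by positivity) (h.mul_abs_response_le (Finset.mem_range.1 ht)) 2
    _ = 4096 * (Real.logb 2 T ^ 2 / T) := by
        rw [Finset.sum_const, Finset.card_range, nsmul_eq_mul]
        field_simp
        norm_num
    _ ≤ _ := by
        gcongr
        exact h.logb_le_momentumA

/-- Eigenvalues beyond k* are overdamped from the first step, because (1 - r)T ≥ 16. -/
theorem sq_le_of_mul_le (h : HeavyBallParams T r q) (hq : q ≤ (1 - r) / T) :
    q ≤ (1 - r) ^ 2 := by
  have hT := h.sixteen_le_cast
  have hδ := h.one_sub_pos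
  refine hq.trans ?_
  rw [div_le_iff₀ (by linarith)]
  nlinarith [h.sixteen_le_mul]

theorem sq_bias_le_of_small (h : HeavyBallParams T r q) (hq : q ≤ (1 - r) / T) (a : ℝ) :
    heavyBallSol (r ^ 2) (stepSize q T) a a (T + 1) ^ 2 ≤ 4 * a ^ 2 := by
  have hδ := h.one_sub_pos
  have hlin := heavyBallSol_linear (r ^ 2) (stepSize q T) a 0 1 1 1 1 (T + 1)
  simp only [mul_one, zero_mul, add_zero] at hlin
  have h1 := heavyBallSol_le_of_mem_cone h.nonneg h.lt_one h.stepSize_nonneg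
    (fun n => (h.stepSize_le n).trans (h.sq_le_of_mul_le hq)) zero_le_one
    (by linarith [h.lt_one]) le_rfl T
  have h2 : Real.exp (-(∑ i ∈ Finset.range T, stepSize q T i) / (2 * (1 - r))) ≤ 1 := by
    rw [Real.exp_le_one_iff, neg_div, neg_nonpos]
    exact div_nonneg (Finset.sum_nonneg fun i _ => h.stepSize_nonneg _) (by positivity)
  have h3 : |heavyBallSol (r ^ 2) (stepSize q T) 1 1 (T + 1)| ≤ 2 := by linarith
  rw [hlin, mul_pow, mul_comm, ← sq_abs (heavyBallSol (r ^ 2) (stepSize q T) 1 1 (T + 1))]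
  have h4 := pow_le_pow_left₀ (abs_nonneg _) h3 2
  nlinarith [sq_nonneg a]

theorem sq_response_le_of_small (h : HeavyBallParams T r q) (hq : q ≤ (1 - r) / T) {t : ℕ}
    (ht : t < T) :
    heavyBallSol (r ^ 2) (fun i => stepSize q T (t + 1 + i)) 0 1 (T - t) ^ 2 ≤
      16 * (1 / (1 - r) ^ 2) := by
  have hδ := h.one_sub_pos
  have h1 := heavyBallSol_abs_le_overdamped h.nonneg h.lt_one
    (p := fun i => stepSize q T (t + 1 + i)) (fun n => h.stepSize_nonneg _)
    (fun n => (h.stepSize_le _).trans (h.sq_le_of_mul_le hq)) 0 1 (T - (t + 1))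
  have h2 : Real.exp (-(∑ i ∈ Finset.range (T - (t + 1)), stepSize q T (t + 1 + i))
      / (2 * (1 - r))) ≤ 1 := by
    rw [Real.exp_le_one_iff, neg_div, neg_nonpos]
    exact div_nonneg (Finset.sum_nonneg fun i _ => h.stepSize_nonneg _) (by positivity)
  have h3 := h1.trans (mul_le_mul_of_nonneg_left h2 (by positivity))
  rw [show T - (t + 1) + 1 = T - t by omega] at h3
  rw [← sq_abs]
  refine (pow_le_pow_left₀ (abs_nonneg _) h3 2).trans_eq ?_
  rw [abs_zero, abs_one]
  field_simp
  ring

end HeavyBallParams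

/-! ### The quadratic objective and its spectral decomposition. -/

namespace StochasticQuadratic

variable {Ξ : Type*} [MeasurableSpace Ξ] {d : ℕ} (Q : StochasticQuadratic Ξ d)

theorem integrable_toEuclideanLin_H (w : EuclideanSpace ℝ (Fin d)) :
    Integrable (fun s => Matrix.toEuclideanLin (Q.H s) w) Q.law := by
  rw [integrable_piLp_iff]
  intro i
  simp only [Matrix.ofLp_toLpLin, Matrix.toLin'_apply, Matrix.mulVec, dotProduct]
  exact integrable_finsetSum _ fun j _ => (Q.integrable_H i j).mul_const _

theorem integral_toEuclideanLin_H (w : EuclideanSpace ℝ (Fin d)) :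
    ∫ s, Matrix.toEuclideanLin (Q.H s) w ∂Q.law = Matrix.toEuclideanLin Q.meanH w := by
  ext i
  rw [eval_integral_piLp fun i => integrable_piLp_iff.1 (Q.integrable_toEuclideanLin_H w) i]
  simp only [Matrix.ofLp_toLpLin, Matrix.toLin'_apply, Matrix.mulVec, dotProduct, meanH, Matrix.of_apply]
  rw [integral_finsetSum _ fun j _ => (Q.integrable_H i j).mul_const _]
  simp only [integral_mul_const]

theorem integrable_stochGrad (w : EuclideanSpace ℝ (Fin d)) :
    Integrable (Q.stochGrad w) Q.law :=
  (Q.integrable_toEuclideanLin_H w).sub Q.integrable_b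

theorem integral_stochGrad (w : EuclideanSpace ℝ (Fin d)) :
    ∫ s, Q.stochGrad w s ∂Q.law = Q.grad w := by
  simp only [stochGrad]
  rw [integral_sub (Q.integrable_toEuclideanLin_H w) Q.integrable_b,
    Q.integral_toEuclideanLin_H]
  rfl

theorem f_eq (w : EuclideanSpace ℝ (Fin d)) :
    Q.f w = 1 / 2 * inner ℝ w (Matrix.toEuclideanLin Q.meanH w) - inner ℝ w Q.meanB := by
  have h1 := Q.integrable_toEuclideanLin_H w
  simp only [f, F]
  rw [integral_sub ((h1.const_inner w).const_mul _) (Q.integrable_b.inner_const w),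
    integral_const_mul, integral_inner h1, Q.integral_toEuclideanLin_H]
  simp only [real_inner_comm w]
  rw [integral_inner Q.integrable_b]
  rfl

theorem meanH_isHermitian : Q.meanH.IsHermitian := by
  ext i j
  simp only [Matrix.conjTranspose_apply, meanH, Matrix.of_apply, star_trivial]
  refine integral_congr_ae (Filter.Eventually.of_forall fun s => ?_)
  simpa using (Q.posSemidef_H s).isHermitian.apply i j

theorem inner_meanH_comm (x y : EuclideanSpace ℝ (Fin d)) :
    inner ℝ (Matrix.toEuclideanLin Q.meanH x) y = inner ℝ x (Matrix.toEuclideanLin Q.meanH y) :=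
  Matrix.isSymmetric_toEuclideanLin_iff.2 Q.meanH_isHermitian x y

theorem inner_meanH_nonneg (x : EuclideanSpace ℝ (Fin d)) :
    0 ≤ inner ℝ x (Matrix.toEuclideanLin Q.meanH x) := by
  rw [← Q.integral_toEuclideanLin_H, ← integral_inner (Q.integrable_toEuclideanLin_H x)]
  refine integral_nonneg fun s => ?_
  have h := (Matrix.isPositive_toEuclideanLin_iff.2 (Q.posSemidef_H s)).re_inner_nonneg_right x
  simpa using h

theorem f_add (w h : EuclideanSpace ℝ (Fin d)) :
    Q.f (w + h) = Q.f w + inner ℝ h (Q.grad w)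
      + 1 / 2 * inner ℝ h (Matrix.toEuclideanLin Q.meanH h) := by
  simp only [f_eq, grad, map_add, inner_add_left, inner_add_right, inner_sub_right]
  rw [← Q.inner_meanH_comm w h, real_inner_comm h (Matrix.toEuclideanLin Q.meanH w)]
  ring

/-- A gradient step of length 1 / (1 + c), with c the curvature along g, would strictly decrease `f`
if g ≠ 0; the 1 keeps the denominator positive. -/
theorem grad_eq_zero_of_isMinOn {w : EuclideanSpace ℝ (Fin d)} (hw : IsMinOn Q.f Set.univ w) :
    Q.grad w = 0 := by
  set g := Q.grad w with hg
  set c := inner ℝ g (Matrix.toEuclideanLin Q.meanH g) with hc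
  set n := inner ℝ g g with hn
  have hc0 : 0 ≤ c := Q.inner_meanH_nonneg g
  have h1 : Q.f w ≤ Q.f (w + -(n / (1 + c)) • g) := isMinOn_univ_iff.1 hw _
  rw [f_add, ← hg, map_smul, real_inner_smul_left, real_inner_smul_left, real_inner_smul_right,
    ← hc, ← hn] at h1
  have h2 : n ^ 2 * (1 + c) ≤ n ^ 2 * (c / 2) := by
    have h3 : n ^ 2 / (1 + c) ≤ n ^ 2 * (c / 2) / (1 + c) ^ 2 := by
      have e1 : n ^ 2 / (1 + c) = n / (1 + c) * n := by ring
      have e2 : n ^ 2 * (c / 2) / (1 + c) ^ 2 = 1 / 2 * (n / (1 + c) * (n / (1 + c) * c)) := by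
        field_simp
      linarith
    rw [div_le_div_iff₀ (by positivity) (by positivity)] at h3
    refine le_of_mul_le_mul_right ?_ (by positivity : 0 < 1 + c)
    linarith
  have h3 : n ^ 2 ≤ 0 := by nlinarith [sq_nonneg n]
  exact inner_self_eq_zero.1 (pow_eq_zero_iff two_ne_zero |>.1 (le_antisymm h3 (sq_nonneg n)))

theorem f_sub_eq {wstar : EuclideanSpace ℝ (Fin d)} (hw : IsMinOn Q.f Set.univ wstar)
    (v : OrthonormalBasis (Fin d) ℝ (EuclideanSpace ℝ (Fin d))) {lam : Fin d → ℝ}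
    (hv : ∀ j, Matrix.toEuclideanLin Q.meanH (v j) = lam j • v j) (w : EuclideanSpace ℝ (Fin d)) :
    Q.f w = Q.f wstar + ∑ j, 1 / 2 * lam j * inner ℝ (v j) (w - wstar) ^ 2 := by
  have h := Q.f_add wstar (w - wstar)
  rw [add_sub_cancel, Q.grad_eq_zero_of_isMinOn hw, inner_zero_right, add_zero,
    ← v.sum_inner_mul_inner] at h
  rw [h, Finset.mul_sum]
  congr 1
  refine Finset.sum_congr rfl fun j _ => ?_
  rw [← Q.inner_meanH_comm, hv, real_inner_smul_left, real_inner_comm (v j)]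
  ring

theorem eigenvalue_nonneg (v : OrthonormalBasis (Fin d) ℝ (EuclideanSpace ℝ (Fin d)))
    {lam : Fin d → ℝ} (hv : ∀ j, Matrix.toEuclideanLin Q.meanH (v j) = lam j • v j) (j : Fin d) :
    0 ≤ lam j := by
  have h := Q.inner_meanH_nonneg (v j)
  rwa [hv, real_inner_smul_right, real_inner_self_eq_norm_sq, v.norm_eq_one, one_pow,
    mul_one] at h

theorem measurable_stochGrad :
    Measurable fun p : EuclideanSpace ℝ (Fin d) × Ξ => Q.stochGrad p.1 p.2 := by
  refine Measurable.sub ?_ (Q.measurable_b.comp measurable_snd)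
  refine (WithLp.measurable_toLp 2 _).comp (measurable_pi_lambda _ fun i => ?_)
  change Measurable fun p : EuclideanSpace ℝ (Fin d) × Ξ => ∑ j, Q.H p.2 i j * p.1 j
  refine Finset.measurable_sum _ fun j _ => ((Q.measurable_H i j).comp measurable_snd).mul ?_
  exact (measurable_pi_apply j).comp ((WithLp.measurable_ofLp 2 _).comp measurable_fst)

theorem _root_.Measurable.stochGrad {α : Type*} {_ : MeasurableSpace α}
    {g : α → EuclideanSpace ℝ (Fin d)} {s : α → Ξ} (hg : Measurable g) (hs : Measurable s) :
    Measurable fun a => Q.stochGrad (g a) (s a) := by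
  have h := Q.measurable_stochGrad.comp (hg.prodMk hs)
  exact h

theorem measurable_grad : Measurable Q.grad :=
  ((Matrix.toEuclideanLin Q.meanH).continuous_of_finiteDimensional.sub continuous_const).measurable

/-! ### Measurability of the iterates and moments of the gradient noise. -/

section Iterates

variable {Ω : Type*} {ξ : ℕ → Ω → Ξ} {η : ℕ → ℝ} {β : ℝ} {w₀ : EuclideanSpace ℝ (Fin d)}
  {w : ℕ → Ω → EuclideanSpace ℝ (Fin d)}

/-- The information carried by the samples `ξ i` with `i < t`. -/
@[reducible]
def past (ξ : ℕ → Ω → Ξ) (t : ℕ) : MeasurableSpace Ω :=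
  ⨆ i ∈ Set.Iio t, MeasurableSpace.comap (ξ i) inferInstance

theorem past_mono (ξ : ℕ → Ω → Ξ) : Monotone (past ξ) := fun _ _ h =>
  biSup_mono fun _ hi => lt_of_lt_of_le hi h

theorem measurable_past (ξ : ℕ → Ω → Ξ) {s t : ℕ} (h : s < t) : Measurable[past ξ t] (ξ s) :=
  measurable_iff_comap_le.2 (le_biSup (fun i => MeasurableSpace.comap (ξ i) inferInstance) h)

theorem past_le [mΩ : MeasurableSpace Ω] (hξ : ∀ t, Measurable (ξ t)) (t : ℕ) : past ξ t ≤ mΩ :=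
  iSup₂_le fun i _ => (hξ i).comap_le

theorem measurable_heavyBall (t : ℕ) :
    Measurable[past ξ t] fun ω => Q.heavyBall η β w₀ (fun s => ξ s ω) t := by
  induction t with
  | zero => exact @measurable_const _ _ _ (past ξ 0) _
  | succ t ih =>
    have h := ih.mono (past_mono ξ (Nat.le_succ t)) le_rfl
    let := past ξ (t + 1)
    have h1 : Measurable fun ω =>
        Q.stochGrad (Q.heavyBall η β w₀ (fun s => ξ s ω) t).1 (ξ t ω) :=
      h.fst.stochGrad Q (measurable_past ξ (Nat.lt_succ_self t))
    have h2 : Measurable fun ω => β • (Q.heavyBall η β w₀ (fun s => ξ s ω) t).2 + η t •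
        Q.stochGrad (Q.heavyBall η β w₀ (fun s => ξ s ω) t).1 (ξ t ω) :=
      (h.snd.const_smul β).add (h1.const_smul (η t))
    exact (h.fst.sub h2).prodMk h2

theorem measurable_gradNoise (hw : ∀ t, Measurable[past ξ t] (w t)) {s t : ℕ} (h : s < t) :
    Measurable[past ξ t] (Q.gradNoise ξ w s) := by
  have h1 := (hw s).mono (past_mono ξ h.le) le_rfl
  have h2 := measurable_past ξ h
  let := past ξ t
  exact (h1.stochGrad Q h2).sub (Q.measurable_grad.comp h1)

variable [MeasurableSpace Ω] {μ : Measure Ω} [IsProbabilityMeasure μ]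

/-- The pair (w_t, Z) depends on earlier samples only, hence is independent of the current one. By
Fubini the current sample is integrated first with that pair frozen, and the stochastic gradient
averages to the gradient. Orthogonality thus holds against the whole past. -/
theorem integral_mul_inner_gradNoise (hξ : ∀ t, Measurable (ξ t)) (hind : iIndepFun ξ μ)
    (hlaw : ∀ t, Measure.map (ξ t) μ = Q.law) (hw : ∀ t, Measurable[past ξ t] (w t)) {t : ℕ}
    {Z : Ω → ℝ} (hZ : Measurable[past ξ t] Z) (x : EuclideanSpace ℝ (Fin d))
    (hint : Integrable (fun ω => Z ω * inner ℝ x (Q.gradNoise ξ w t ω)) μ) :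
    ∫ ω, Z ω * inner ℝ x (Q.gradNoise ξ w t ω) ∂μ = 0 := by
  have := Q.isProb
  set X : Ω → EuclideanSpace ℝ (Fin d) × ℝ := fun ω => (w t ω, Z ω) with hX
  have hXp : Measurable[past ξ t] X := (hw t).prodMk hZ
  have hXm : Measurable X := hXp.mono (past_le hξ t) le_rfl
  have hindep : X ⟂ᵢ[μ] (ξ t) := by
    rw [IndepFun_iff_Indep]
    have h1 := indep_iSup_of_disjoint (fun i => (hξ i).comap_le)
      ((iIndepFun_iff_iIndep _ _ _).1 hind) (S := Set.Iio t) (T := {t}) (by simp)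
    rw [iSup_singleton] at h1
    exact indep_of_indep_of_le_left h1 (measurable_iff_comap_le.1 hXp)
  have hmap := (indepFun_iff_map_prod_eq_prod_map_map hXm.aemeasurable (hξ t).aemeasurable).1 hindep
  rw [hlaw] at hmap
  set G : (EuclideanSpace ℝ (Fin d) × ℝ) × Ξ → ℝ := fun p =>
    p.1.2 * inner ℝ x (Q.stochGrad p.1.1 p.2 - Q.grad p.1.1) with hG
  have hGm : Measurable G := by
    refine measurable_fst.snd.mul (measurable_const.inner (Measurable.sub ?_ ?_))
    · exact measurable_fst.fst.stochGrad Q measurable_snd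
    · exact Q.measurable_grad.comp measurable_fst.fst
  have hpair : Measurable fun ω => (X ω, ξ t ω) := hXm.prodMk (hξ t)
  have hprob : IsProbabilityMeasure (Measure.map X μ) :=
    Measure.isProbabilityMeasure_map hXm.aemeasurable
  have hGint : Integrable G ((Measure.map X μ).prod Q.law) := by
    rw [← hmap, integrable_map_measure hGm.aestronglyMeasurable hpair.aemeasurable]
    exact hint
  calc ∫ ω, Z ω * inner ℝ x (Q.gradNoise ξ w t ω) ∂μ
      = ∫ p, G p ∂Measure.map (fun ω => (X ω, ξ t ω)) μ :=
        (integral_map hpair.aemeasurable hGm.aestronglyMeasurable).symm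
    _ = ∫ y, ∫ s, G (y, s) ∂Q.law ∂Measure.map X μ := by rw [hmap, integral_prod G hGint]
    _ = 0 := by
      refine integral_eq_zero_of_ae (Filter.Eventually.of_forall fun y => ?_)
      simp only [hG, Pi.zero_apply]
      have h2 := (Q.integrable_stochGrad y.1).sub (integrable_const (Q.grad y.1))
      rw [integral_const_mul]
      have h3 := integral_inner (𝕜 := ℝ) h2 x
      simp only [Pi.sub_apply] at h3
      rw [h3, integral_sub (Q.integrable_stochGrad y.1) (integrable_const _), Q.integral_stochGrad]
      simp

/-- The square is expanded in coordinates so that each product can be replaced by its conditional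
expectation; the matrix bound is then tested on `x`. -/
theorem integral_sq_inner_gradNoise_le {T : ℕ} {σ : ℝ} (hw : ∀ t, Measurable (w t))
    (hnoise : Q.AnisotropicNoise μ ξ w T σ) {t : ℕ} (ht : t < T) (x : EuclideanSpace ℝ (Fin d)) :
    ∫ ω, inner ℝ x (Q.gradNoise ξ w t ω) ^ 2 ∂μ ≤
      σ ^ 2 * inner ℝ x (Matrix.toEuclideanLin Q.meanH x) := by
  have hm : MeasurableSpace.comap (w t) inferInstance ≤ (inferInstance : MeasurableSpace Ω) :=
    (hw t).comap_le
  set ζ := Q.gradNoise ξ w t with hζ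
  have hL : ∀ i, MemLp (fun ω => ζ ω i) 2 μ := memLp_piLp_iff.1 (hnoise.memLp t ht)
  have hI : ∀ i j, Integrable (fun ω => ζ ω i * ζ ω j) μ := fun i j =>
    (hL i).integrable_mul (hL j)
  set M : Fin d → Fin d → Ω → ℝ := fun i j =>
    condExp (MeasurableSpace.comap (w t) inferInstance) μ (fun ω' => ζ ω' i * ζ ω' j) with hM
  have hsq : ∀ ω, inner ℝ x (ζ ω) ^ 2 = ∑ i, ∑ j, x i * x j * (ζ ω i * ζ ω j) := by
    intro ω
    rw [PiLp.inner_apply, sq, Finset.sum_mul_sum]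
    refine Finset.sum_congr rfl fun i _ => Finset.sum_congr rfl fun j _ => ?_
    simp only [RCLike.inner_apply, conj_trivial]
    ring
  have h1 : ∫ ω, inner ℝ x (ζ ω) ^ 2 ∂μ = ∫ ω, ∑ i, ∑ j, x i * x j * M i j ω ∂μ := by
    simp only [hsq]
    rw [integral_finsetSum _ fun i _ => integrable_finsetSum _ fun j _ => (hI i j).const_mul _,
      integral_finsetSum _ fun i _ => integrable_finsetSum _ fun j _ =>
        integrable_condExp.const_mul _]
    refine Finset.sum_congr rfl fun i _ => ?_
    rw [integral_finsetSum _ fun j _ => (hI i j).const_mul _,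
      integral_finsetSum _ fun j _ => integrable_condExp.const_mul _]
    refine Finset.sum_congr rfl fun j _ => ?_
    rw [integral_const_mul, integral_const_mul, hM, integral_condExp hm]
  rw [h1]
  have h2 : ∀ᵐ ω ∂μ, ∑ i, ∑ j, x i * x j * M i j ω ≤
      σ ^ 2 * inner ℝ x (Matrix.toEuclideanLin Q.meanH x) := by
    filter_upwards [hnoise.second_moment_le t ht] with ω hω
    have h3 := hω.dotProduct_mulVec_nonneg x.ofLp
    rw [star_trivial, Matrix.sub_mulVec, dotProduct_sub, Matrix.smul_mulVec, dotProduct_smul,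
      sub_nonneg, smul_eq_mul] at h3
    refine le_trans (le_of_eq ?_) (h3.trans_eq ?_)
    · simp only [dotProduct, Matrix.mulVec, Matrix.of_apply, Finset.mul_sum]
      refine Finset.sum_congr rfl fun i _ => Finset.sum_congr rfl fun j _ => ?_
      ring
    · rw [PiLp.inner_apply]
      simp only [Matrix.ofLp_toLpLin, Matrix.toLin'_apply, RCLike.inner_apply, conj_trivial, dotProduct,
        mul_comm]
  calc _ ≤ ∫ _ω, σ ^ 2 * inner ℝ x (Matrix.toEuclideanLin Q.meanH x) ∂μ :=
        integral_mono_ae (integrable_finsetSum _ fun i _ => integrable_finsetSum _ fun j _ =>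
          integrable_condExp.const_mul _) (integrable_const _) h2
    _ = _ := by simp

end Iterates

end StochasticQuadratic

/-! ### Bias-variance decomposition of the last iterate. -/

/-- Variation of constants for the heavy ball method driven by the noise `z`. -/
theorem heavyBall_eq_sol_sub_sum {β : ℝ} {p η x u z : ℕ → ℝ} (hu : u 0 = 0)
    (hu' : ∀ t, u (t + 1) = β * u t + (p t * x t + η t * z t))
    (hx : ∀ t, x (t + 1) = x t - u (t + 1)) (t : ℕ) :
    x t = heavyBallSol β p (x 0) (x 0) (t + 1)
      - ∑ s ∈ Finset.range t, η s * heavyBallSol β (fun i => p (s + 1 + i)) 0 1 (t - s) * z s := by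
  induction t using Nat.twoStepInduction with
  -- The index t + 1 reflects a fictitious iterate before time 0: zero initial velocity means that
  -- it equals x 0.
  | zero => simp [heavyBallSol]
  | one =>
    rw [hx, hu', hu]
    simp [heavyBallSol]
    ring
  | more t ih₀ ih₁ =>
    -- The added term vanishes since a response starts at 0; all three sums then share one range.
    have h0 : ∑ s ∈ Finset.range t,
        η s * heavyBallSol β (fun i => p (s + 1 + i)) 0 1 (t - s) * z s =
        ∑ s ∈ Finset.range (t + 1),
          η s * heavyBallSol β (fun i => p (s + 1 + i)) 0 1 (t - s) * z s := by
      rw [Finset.sum_range_succ, Nat.sub_self]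
      simp [heavyBallSol]
    rw [h0] at ih₀
    have h1 : x (t + 2) = (1 + β - p (t + 1)) * x (t + 1) - β * x t - η (t + 1) * z (t + 1) := by
      linarith [hx (t + 1), hu' (t + 1), congrArg (β * ·) (hx t)]
    have h2 : ∑ s ∈ Finset.range (t + 1),
          η s * heavyBallSol β (fun i => p (s + 1 + i)) 0 1 (t + 2 - s) * z s =
        (1 + β - p (t + 1)) * ∑ s ∈ Finset.range (t + 1),
          η s * heavyBallSol β (fun i => p (s + 1 + i)) 0 1 (t + 1 - s) * z s
        - β * ∑ s ∈ Finset.range (t + 1),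
          η s * heavyBallSol β (fun i => p (s + 1 + i)) 0 1 (t - s) * z s := by
      rw [Finset.mul_sum, Finset.mul_sum, ← Finset.sum_sub_distrib]
      refine Finset.sum_congr rfl fun s hs => ?_
      have hst : s ≤ t := Nat.lt_succ_iff.1 (Finset.mem_range.1 hs)
      rw [show t + 2 - s = t - s + 2 by omega, show t + 1 - s = t - s + 1 by omega, heavyBallSol,
        show s + 1 + (t - s) = t + 1 by omega]
      ring
    have h3 : heavyBallSol β p (x 0) (x 0) (t + 2 + 1) =
        (1 + β - p (t + 1)) * heavyBallSol β p (x 0) (x 0) (t + 1 + 1)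
          - β * heavyBallSol β p (x 0) (x 0) (t + 1) := rfl
    rw [Finset.sum_range_succ, h2, h3, h1, show t + 2 - (t + 1) = 1 by omega]
    have h4 : heavyBallSol β (fun i => p (t + 1 + 1 + i)) 0 1 1 = 1 := rfl
    rw [h4]
    linear_combination (1 + β - p (t + 1)) * ih₁ - β * ih₀

/-- A deterministic number minus a combination of successively centred noises. -/
theorem integral_sq_sub_sum_le {Ω : Type*} {mΩ : MeasurableSpace Ω} {μ : Measure Ω}
    [IsProbabilityMeasure μ] {ℱ : ℕ → MeasurableSpace Ω} (hℱ : Monotone ℱ) {z : ℕ → Ω → ℝ} {V : ℝ}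
    {T : ℕ} (hz : ∀ t < T, Measurable[ℱ (t + 1)] (z t)) (hL : ∀ t < T, MemLp (z t) 2 μ)
    (hV : ∀ t < T, ∫ ω, z t ω ^ 2 ∂μ ≤ V)
    (horth : ∀ t < T, ∀ Z : Ω → ℝ, Measurable[ℱ t] Z → Integrable (fun ω => Z ω * z t ω) μ →
      ∫ ω, Z ω * z t ω ∂μ = 0) (B : ℝ) (c : ℕ → ℝ) :
    MemLp (fun ω => B - ∑ t ∈ Finset.range T, c t * z t ω) 2 μ ∧
      ∫ ω, (B - ∑ t ∈ Finset.range T, c t * z t ω) ^ 2 ∂μ ≤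
        B ^ 2 + (∑ t ∈ Finset.range T, c t ^ 2) * V := by
  have hmeas : ∀ n ≤ T, Measurable[ℱ n] fun ω => B - ∑ t ∈ Finset.range n, c t * z t ω := by
    intro n hn
    have h : ∀ t < n, Measurable[ℱ n] (z t) := fun t ht =>
      (hz t (by omega)).mono (hℱ (Nat.succ_le_of_lt ht)) le_rfl
    let := ℱ n
    exact measurable_const.sub (Finset.measurable_sum _ fun t ht =>
      (h t (Finset.mem_range.1 ht)).const_mul _)
  have hmem : ∀ n ≤ T, MemLp (fun ω => B - ∑ t ∈ Finset.range n, c t * z t ω) 2 μ := fun n hn =>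
    (memLp_const B).sub (memLp_finsetSum _ fun t ht =>
      (hL t (by have := Finset.mem_range.1 ht; omega)).const_mul _)
  refine ⟨hmem T le_rfl, ?_⟩
  suffices h : ∀ n ≤ T, ∫ ω, (B - ∑ t ∈ Finset.range n, c t * z t ω) ^ 2 ∂μ ≤
      B ^ 2 + (∑ t ∈ Finset.range n, c t ^ 2) * V from h T le_rfl
  intro n
  induction n with
  | zero => intro _; simp
  | succ n ih =>
    intro hn
    have hS := hmem n (by omega)
    have hzn := hL n (by omega)
    have hint : Integrable (fun ω => (B - ∑ t ∈ Finset.range n, c t * z t ω) * z n ω) μ :=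
      hS.integrable_mul hzn
    -- The partial error depends only on the past of step n, so the cross term vanishes.
    have h0 := horth n (by omega) _ (hmeas n (by omega)) hint
    have e : ∀ ω, (B - ∑ t ∈ Finset.range (n + 1), c t * z t ω) ^ 2 =
        (B - ∑ t ∈ Finset.range n, c t * z t ω) ^ 2
          - 2 * c n * ((B - ∑ t ∈ Finset.range n, c t * z t ω) * z n ω)
          + c n ^ 2 * z n ω ^ 2 := fun ω => by
      rw [Finset.sum_range_succ]
      ring
    simp only [e]
    have hdiff : Integrable (fun ω => (B - ∑ t ∈ Finset.range n, c t * z t ω) ^ 2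
        - 2 * c n * ((B - ∑ t ∈ Finset.range n, c t * z t ω) * z n ω)) μ :=
      hS.integrable_sq.sub (hint.const_mul _)
    rw [integral_add hdiff (hzn.integrable_sq.const_mul _),
      integral_sub hS.integrable_sq (hint.const_mul _), integral_const_mul, integral_const_mul, h0,
      Finset.sum_range_succ]
    have := mul_le_mul_of_nonneg_left (hV n (by omega)) (sq_nonneg (c n))
    linarith [ih (by omega)]

namespace StochasticQuadratic

variable {Ω Ξ : Type*} [MeasurableSpace Ξ] {d : ℕ} (Q : StochasticQuadratic Ξ d) {ξ : ℕ → Ω → Ξ}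
  {w : ℕ → Ω → EuclideanSpace ℝ (Fin d)} {wstar : EuclideanSpace ℝ (Fin d)} {η : ℕ → ℝ}
  {σ β : ℝ} {T : ℕ}

/-- The error of the heavy ball method along an eigenvector `x` of the Hessian. -/
theorem inner_heavyBall_sub (hstar : Q.grad wstar = 0)
    (hw : ∀ t ω, w t ω = (Q.heavyBall η β 0 (fun s => ξ s ω) t).1)
    {x : EuclideanSpace ℝ (Fin d)} {l : ℝ} (hx : Matrix.toEuclideanLin Q.meanH x = l • x)
    (t : ℕ) (ω : Ω) :
    inner ℝ x (w t ω - wstar) =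
      heavyBallSol β (fun t => l * η t) (-inner ℝ x wstar) (-inner ℝ x wstar) (t + 1)
      - ∑ s ∈ Finset.range t, η s *
        heavyBallSol β (fun i => l * η (s + 1 + i)) 0 1 (t - s) *
          inner ℝ x (Q.gradNoise ξ w s ω) := by
  have hgrad : ∀ y, inner ℝ x (Q.grad y) = l * inner ℝ x (y - wstar) := by
    intro y
    have h1 : Q.grad y = Matrix.toEuclideanLin Q.meanH (y - wstar) := by
      rw [← sub_zero (Q.grad y), ← hstar, grad, grad, map_sub]
      abel
    rw [h1, ← Q.inner_meanH_comm, hx, real_inner_smul_left]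
  have h0 : inner ℝ x (w 0 ω - wstar) = -inner ℝ x wstar := by
    rw [hw]
    simp [heavyBall]
  have h := heavyBall_eq_sol_sub_sum (β := β) (p := fun t => l * η t) (η := η)
    (x := fun t => inner ℝ x (w t ω - wstar))
    (u := fun t => inner ℝ x (Q.heavyBall η β 0 (fun s => ξ s ω) t).2)
    (z := fun t => inner ℝ x (Q.gradNoise ξ w t ω)) (by simp [heavyBall])
    (fun t => by
      have e : Q.stochGrad (w t ω) (ξ t ω) = Q.gradNoise ξ w t ω + Q.grad (w t ω) := by
        rw [gradNoise, sub_add_cancel]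
      simp only [heavyBall]
      rw [← hw, e, inner_add_right, real_inner_smul_right, real_inner_smul_right, inner_add_right,
        hgrad]
      ring)
    (fun t => by
      simp only [hw, heavyBall, inner_sub_right]
      ring) t
  simp only [h0] at h
  exact h

theorem integral_sq_inner_heavyBall_le [MeasurableSpace Ω] {μ : Measure Ω}
    [IsProbabilityMeasure μ] (hξ : ∀ t, Measurable (ξ t)) (hind : iIndepFun ξ μ)
    (hlaw : ∀ t, Measure.map (ξ t) μ = Q.law) (hstar : Q.grad wstar = 0)
    (hw : ∀ t ω, w t ω = (Q.heavyBall η β 0 (fun s => ξ s ω) t).1)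
    (hnoise : Q.AnisotropicNoise μ ξ w T σ)
    {x : EuclideanSpace ℝ (Fin d)} (hx1 : ‖x‖ = 1) {l : ℝ}
    (hx : Matrix.toEuclideanLin Q.meanH x = l • x) :
    MemLp (fun ω => inner ℝ x (w T ω - wstar)) 2 μ ∧
    ∫ ω, inner ℝ x (w T ω - wstar) ^ 2 ∂μ ≤
      heavyBallSol β (fun t => l * η t) (-inner ℝ x wstar) (-inner ℝ x wstar) (T + 1) ^ 2
      + (∑ t ∈ Finset.range T,
        (η t * heavyBallSol β (fun i => l * η (t + 1 + i)) 0 1 (T - t)) ^ 2) * (σ ^ 2 * l) := by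
  have hwp : ∀ t, Measurable[past ξ t] (w t) := fun t => by
    have h := Q.measurable_heavyBall (ξ := ξ) (η := η) (β := β) (w₀ := 0) t
    rw [show w t = fun ω => (Q.heavyBall η β 0 (fun s => ξ s ω) t).1 from funext (hw t)]
    exact h.fst
  simp only [Q.inner_heavyBall_sub hstar hw hx]
  refine integral_sq_sub_sum_le (past_mono ξ) (T := T)
    (z := fun t ω => inner ℝ x (Q.gradNoise ξ w t ω)) (fun t _ => ?_)
    (fun t ht => (hnoise.memLp t ht).const_inner x) (fun t ht => ?_)
    (fun t _ Z hZ hint => Q.integral_mul_inner_gradNoise hξ hind hlaw hwp hZ x hint) _ _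
  · have h := Q.measurable_gradNoise hwp (Nat.lt_succ_self t)
    let := past ξ (t + 1)
    exact measurable_const.inner h
  · refine (Q.integral_sq_inner_gradNoise_le (fun t => (hwp t).mono (past_le hξ t) le_rfl)
      hnoise ht x).trans_eq ?_
    rw [hx, real_inner_smul_right, real_inner_self_eq_norm_sq, hx1]
    ring

end StochasticQuadratic

/-! ### Risk per eigenvector and summation. -/

namespace HeavyBallParams

variable {T : ℕ} {r l η₀ : ℝ}

/-- The contribution of one eigenvector with error `c` to the risk, for every eigenvalue. -/
theorem risk_le (h : HeavyBallParams T r (l * η₀)) (hη : 0 < η₀) (σ c : ℝ) :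
    1 / 2 * l * (heavyBallSol (r ^ 2) (fun t => l * stepSize η₀ T t) (-c) (-c) (T + 1) ^ 2
      + (∑ t ∈ Finset.range T, (stepSize η₀ T t *
          heavyBallSol (r ^ 2) (fun i => l * stepSize η₀ T (t + 1 + i)) 0 1 (T - t)) ^ 2)
        * (σ ^ 2 * l)) ≤
      8 * (Real.logb 2 T ^ 2 * momentumA T * (1 - r) / (η₀ * T) * c ^ 2)
        + 4096 * σ ^ 2 * (momentumA T ^ 2 / T) := by
  have hT := h.sixteen_le_cast
  have hL := h.four_le_logb
  have hA := h.logb_le_momentumA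
  have hδ := h.one_sub_pos
  have h1 := h.mul_sq_bias_le (-c)
  have h2 := h.sum_sq_response_le
  have hA2 : 0 ≤ momentumA T ^ 2 / T := by positivity
  simp only [mul_stepSize]
  rw [neg_sq] at h1
  set B := heavyBallSol (r ^ 2) (stepSize (l * η₀) T) (-c) (-c) (T + 1) with hB
  have h3 : l * B ^ 2 ≤ 8 * (Real.logb 2 T ^ 2 * momentumA T * (1 - r) / (η₀ * T) * c ^ 2) := by
    calc l * B ^ 2 = l * η₀ * B ^ 2 / η₀ := by field_simp
      _ ≤ 8 * (Real.logb 2 T * (1 - r) / T) * c ^ 2 / η₀ := by gcongr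
      _ = 8 * (Real.logb 2 T * 1 * (1 - r) / (η₀ * T) * c ^ 2) := by field_simp
      _ ≤ 8 * (Real.logb 2 T ^ 2 * momentumA T * (1 - r) / (η₀ * T) * c ^ 2) := by
        gcongr
        · nlinarith
        · linarith
  -- One factor l comes from the risk, the other from the noise covariance; together they turn each
  -- squared step into (l η_t)², giving a bound free of l.
  have h4 : l * (∑ t ∈ Finset.range T, (stepSize η₀ T t *
        heavyBallSol (r ^ 2) (fun i => stepSize (l * η₀) T (t + 1 + i)) 0 1 (T - t)) ^ 2)
        * (σ ^ 2 * l) ≤ 4096 * σ ^ 2 * (momentumA T ^ 2 / T) := by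
    calc _ = σ ^ 2 * ∑ t ∈ Finset.range T, (stepSize (l * η₀) T t *
        heavyBallSol (r ^ 2) (fun i => stepSize (l * η₀) T (t + 1 + i)) 0 1 (T - t)) ^ 2 := by
          rw [mul_right_comm, show l * (σ ^ 2 * l) = σ ^ 2 * l ^ 2 by ring, mul_assoc,
            Finset.mul_sum]
          congr 1
          refine Finset.sum_congr rfl fun t _ => ?_
          rw [← mul_stepSize]
          ring
      _ ≤ σ ^ 2 * (4096 * (momentumA T ^ 2 / T)) := by gcongr
      _ = _ := by ring
  have h5 : 0 ≤ 8 * (Real.logb 2 T ^ 2 * momentumA T * (1 - r) / (η₀ * T) * c ^ 2) := by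
    have : 0 ≤ momentumA T := by linarith
    positivity
  have h6 : 0 ≤ 4096 * σ ^ 2 * (momentumA T ^ 2 / T) := by positivity
  linarith

/-- The contribution of one eigenvector with error `c` to the risk, for small eigenvalues. -/
theorem risk_le_of_small (h : HeavyBallParams T r (l * η₀)) (hl : 0 ≤ l) (hη : 0 < η₀)
    (hs : l * η₀ ≤ (1 - r) / T) (σ c : ℝ) :
    1 / 2 * l * (heavyBallSol (r ^ 2) (fun t => l * stepSize η₀ T t) (-c) (-c) (T + 1) ^ 2
      + (∑ t ∈ Finset.range T, (stepSize η₀ T t *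
          heavyBallSol (r ^ 2) (fun i => l * stepSize η₀ T (t + 1 + i)) 0 1 (T - t)) ^ 2)
        * (σ ^ 2 * l)) ≤
      8 * (l * Real.logb 2 T ^ 2 * c ^ 2)
        + 4096 * σ ^ 2 * (η₀ ^ 2 * (l ^ 2 * T * (1 / (1 - r) ^ 2))) := by
  have hL := h.four_le_logb
  have hδ := h.one_sub_pos
  simp only [mul_stepSize]
  have h1 := h.sq_bias_le_of_small hs (-c)
  rw [neg_sq] at h1
  have h2 : ∑ t ∈ Finset.range T, (stepSize η₀ T t *
      heavyBallSol (r ^ 2) (fun i => stepSize (l * η₀) T (t + 1 + i)) 0 1 (T - t)) ^ 2 ≤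
      T * (η₀ ^ 2 * (16 * (1 / (1 - r) ^ 2))) := by
    calc _ ≤ ∑ _t ∈ Finset.range T, η₀ ^ 2 * (16 * (1 / (1 - r) ^ 2)) := by
          refine Finset.sum_le_sum fun t ht => ?_
          rw [mul_pow]
          have h3 : stepSize η₀ T t ≤ η₀ := by
            rw [stepSize_eq]
            exact div_le_self hη.le (one_le_pow₀ (by norm_num))
          have h4 : 0 ≤ stepSize η₀ T t := by
            rw [stepSize_eq]
            positivity
          have h5 := h.sq_response_le_of_small hs (Finset.mem_range.1 ht)
          gcongr
      _ = _ := by rw [Finset.sum_const, Finset.card_range, nsmul_eq_mul]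
  have h3 : c ^ 2 ≤ Real.logb 2 T ^ 2 * c ^ 2 :=
    le_mul_of_one_le_left (sq_nonneg c) (by nlinarith)
  calc _ ≤ 1 / 2 * l * (4 * (Real.logb 2 T ^ 2 * c ^ 2)
        + T * (η₀ ^ 2 * (16 * (1 / (1 - r) ^ 2))) * (σ ^ 2 * l)) := by
        gcongr
        linarith
    _ = 2 * (l * Real.logb 2 T ^ 2 * c ^ 2)
        + 8 * (σ ^ 2 * (η₀ ^ 2 * (l ^ 2 * T * (1 / (1 - r) ^ 2)))) := by ring
    _ ≤ _ := by
        have h4 : 0 ≤ l * Real.logb 2 T ^ 2 * c ^ 2 := by positivity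
        have h5 : 0 ≤ σ ^ 2 * (η₀ ^ 2 * (l ^ 2 * T * (1 / (1 - r) ^ 2))) := by positivity
        linarith

end HeavyBallParams

theorem mainTheorem1 :
    ∃ C₁ : ℝ, 0 < C₁ ∧ ∃ C₂ : ℝ, 0 < C₂ ∧
      ∀ {Ω Ξ : Type*} [MeasurableSpace Ω] [MeasurableSpace Ξ]
        (μ : Measure Ω) [IsProbabilityMeasure μ]
        (d : ℕ) (hd : 0 < d) (Q : StochasticQuadratic Ξ d)
        -- the samples are independent with the law of the problem
        (ξ : ℕ → Ω → Ξ) (_ : ∀ t, Measurable (ξ t)) (_ : iIndepFun ξ μ)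
        (_ : ∀ t, Measure.map (ξ t) μ = Q.law)
        -- eigenvalues in descending order, and an orthonormal eigenbasis, of the Hessian
        (lam : Fin d → ℝ) (_ : Antitone lam)
        (v : OrthonormalBasis (Fin d) ℝ (EuclideanSpace ℝ (Fin d)))
        (_ : ∀ j, Matrix.toEuclideanLin Q.meanH (v j) = lam j • v j)
        -- an optimum of the objective
        (wstar : EuclideanSpace ℝ (Fin d)) (_ : IsMinOn Q.f Set.univ wstar)
        (σ η₀ β : ℝ) (T : ℕ)
        (_ : 0 < η₀) (_ : η₀ * lam ⟨0, hd⟩ ≤ 1) (_ : 16 ≤ T)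
        (_ : momentumA T ≤ T) (_ : β ∈ Set.Icc 0 ((1 - momentumA T / T) ^ 2))
        -- the iterates, started at `0`
        (w : ℕ → Ω → EuclideanSpace ℝ (Fin d))
        (_ : ∀ t ω, w t ω = (Q.heavyBall (stepSize η₀ T) β 0 (fun s => ξ s ω) t).1)
        (_ : Q.AnisotropicNoise μ ξ w T σ),
        Integrable (fun ω => Q.f (w T ω)) μ ∧
        (∫ ω, Q.f (w T ω) ∂μ) - Q.f wstar ≤
          C₁ * ((∑ j ∈ Finset.univ.filter (fun j : Fin d => (j : ℕ) < kStar lam η₀ β T),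
                  Real.logb 2 T ^ 2 * momentumA T * (1 - √β) / (η₀ * T)
                    * inner ℝ (v j) wstar ^ 2)
              + ∑ j ∈ Finset.univ.filter (fun j : Fin d => kStar lam η₀ β T ≤ (j : ℕ)),
                  lam j * Real.logb 2 T ^ 2 * inner ℝ (v j) wstar ^ 2)
          + C₂ * σ ^ 2 *
              ((lam ⟨0, hd⟩ ^ 2 * η₀ ^ 2 + momentumA T ^ 2) * kStar lam η₀ β T / T
              + η₀ ^ 2 * ∑ j ∈ Finset.univ.filter (fun j : Fin d => kStar lam η₀ β T ≤ (j : ℕ)),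
                  lam j ^ 2 * T * (1 / (1 - √β) ^ 2)) := by
  -- 8 is the bias constant of `mul_sq_bias_le`, and 4096 = 64² squares the response bound of
  -- `mul_abs_response_le`.
  refine ⟨8, by norm_num, 4096, by norm_num, ?_⟩
  intro Ω Ξ _ _ μ _ d hd Q ξ hξ hind hlaw lam hanti v hv wstar hmin σ η₀ β T hη hη1 hT hAT hβ w hw
    hnoise
  have hT0 : (0 : ℝ) < T := by
    have : 0 < T := by omega
    exact_mod_cast this
  have hAT' : 0 ≤ 1 - momentumA T / T := by
    rw [sub_nonneg, div_le_one hT0]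
    exact hAT
  have hlam := Q.eigenvalue_nonneg v hv
  have hr2 : √β ^ 2 = β := Real.sq_sqrt hβ.1
  have hpar : ∀ j, HeavyBallParams T (√β) (lam j * η₀) := fun j =>
    { sixteen_le := hT
      momentumA_le := hAT
      nonneg := Real.sqrt_nonneg β
      le_one_sub := by
        rw [← Real.sqrt_sq hAT']
        exact Real.sqrt_le_sqrt hβ.2
      step_nonneg := mul_nonneg (hlam j) hη.le
      step_le_one := by
        have : lam j ≤ lam ⟨0, hd⟩ := hanti (Nat.zero_le _)
        nlinarith }
  have hE := fun j => Q.integral_sq_inner_heavyBall_le hξ hind hlaw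
    (Q.grad_eq_zero_of_isMinOn hmin) hw hnoise (v.norm_eq_one j) (hv j)
  have hint : ∀ j, Integrable
      (fun ω => 1 / 2 * lam j * inner ℝ (v j) (w T ω - wstar) ^ 2) μ := fun j =>
    (hE j).1.integrable_sq.const_mul _
  have hsum : Integrable
      (fun ω => ∑ j, 1 / 2 * lam j * inner ℝ (v j) (w T ω - wstar) ^ 2) μ :=
    integrable_finsetSum _ fun j _ => hint j
  have hf : (fun ω => Q.f (w T ω)) = fun ω => Q.f wstar
      + ∑ j, 1 / 2 * lam j * inner ℝ (v j) (w T ω - wstar) ^ 2 :=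
    funext fun ω => Q.f_sub_eq hmin v hv (w T ω)
  rw [hf]
  refine ⟨(integrable_const _).add hsum, ?_⟩
  rw [integral_add (integrable_const _) hsum, integral_finsetSum _ fun j _ => hint j,
    integral_const, probReal_univ, one_smul, add_sub_cancel_left]
  simp only [integral_const_mul]
  rw [← Finset.sum_filter_add_sum_filter_not Finset.univ
    (fun j : Fin d => (j : ℕ) < kStar lam η₀ β T)]
  simp only [not_lt]
  set k := kStar lam η₀ β T with hk
  have hA : 0 ≤ momentumA T := by
    linarith [(hpar ⟨0, hd⟩).logb_le_momentumA, (hpar ⟨0, hd⟩).four_le_logb]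
  have hlow : ∀ j : Fin d,
      1 / 2 * lam j * ∫ ω, inner ℝ (v j) (w T ω - wstar) ^ 2 ∂μ ≤
        8 * (Real.logb 2 T ^ 2 * momentumA T * (1 - √β) / (η₀ * T) * inner ℝ (v j) wstar ^ 2)
          + 4096 * σ ^ 2 * ((lam ⟨0, hd⟩ ^ 2 * η₀ ^ 2 + momentumA T ^ 2) / T) := fun j => by
    have h1 := (hpar j).risk_le hη σ (inner ℝ (v j) wstar)
    rw [hr2] at h1
    refine (mul_le_mul_of_nonneg_left (hE j).2
      (mul_nonneg (by norm_num) (hlam j))).trans (h1.trans ?_)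
    gcongr
    exact le_add_of_nonneg_left (by positivity)
  have hhigh : ∀ j : Fin d, k ≤ (j : ℕ) →
      1 / 2 * lam j * ∫ ω, inner ℝ (v j) (w T ω - wstar) ^ 2 ∂μ ≤
        8 * (lam j * Real.logb 2 T ^ 2 * inner ℝ (v j) wstar ^ 2)
          + 4096 * σ ^ 2 * (η₀ ^ 2 * (lam j ^ 2 * T * (1 / (1 - √β) ^ 2))) := fun j hj => by
    have hs : lam j * η₀ ≤ (1 - √β) / T := by
      -- A zero-based j violating the bound would put its one-based index j + 1 in the set defining
      -- k*, contradicting k ≤ j. Monotonicity of the eigenvalues is not needed here.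
      by_contra hn
      have h2 : (j : ℕ) + 1 ≤ k := Finset.le_sup (f := fun j : Fin d => (j : ℕ) + 1)
        (Finset.mem_filter.2 ⟨Finset.mem_univ j, (not_le.1 hn).le⟩)
      omega
    have h1 := (hpar j).risk_le_of_small (hlam j) hη hs σ (inner ℝ (v j) wstar)
    rw [hr2] at h1
    exact (mul_le_mul_of_nonneg_left (hE j).2 (mul_nonneg (by norm_num) (hlam j))).trans h1
  have hcard : ((Finset.univ.filter fun j : Fin d => (j : ℕ) < k).card : ℝ) ≤ k := by
    have h1 : (Finset.univ.filter fun j : Fin d => (j : ℕ) < k).card ≤ (Finset.range k).card :=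
      Finset.card_le_card_of_injOn (fun j => (j : ℕ))
        (fun j hj => by simpa using hj) (Fin.val_injective.injOn)
    rw [Finset.card_range] at h1
    exact_mod_cast h1
  have hS1 := Finset.sum_le_sum fun j (_ : j ∈ Finset.univ.filter fun j : Fin d => (j : ℕ) < k) =>
    hlow j
  have hS2 := Finset.sum_le_sum fun j (hj : j ∈ Finset.univ.filter fun j : Fin d => k ≤ (j : ℕ)) =>
    hhigh j (Finset.mem_filter.1 hj).2
  rw [Finset.sum_add_distrib, ← Finset.mul_sum, Finset.sum_const, nsmul_eq_mul] at hS1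
  rw [Finset.sum_add_distrib, ← Finset.mul_sum, ← Finset.mul_sum, ← Finset.mul_sum] at hS2
  have hC : ((Finset.univ.filter fun j : Fin d => (j : ℕ) < k).card : ℝ)
      * (4096 * σ ^ 2 * ((lam ⟨0, hd⟩ ^ 2 * η₀ ^ 2 + momentumA T ^ 2) / T)) ≤
      4096 * σ ^ 2 * ((lam ⟨0, hd⟩ ^ 2 * η₀ ^ 2 + momentumA T ^ 2) * k / T) := by
    refine (mul_le_mul_of_nonneg_right hcard (by positivity)).trans_eq ?_
    ring
  linarith
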